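/- Let $G$ be a Lie group of even dimension, let $H$ be a closed connected subgroup of $G$, let $\mathfrak h\subset\mathfrak g=T_1G$ be the Lie algebras, and let $\pi:G\to G/H$ be the projection. Let $B$ be a non-degenerate symmetric bilinear form on $\mathfrak g$ which is invariant under $\operatorname{Ad}(H)$ and whose restriction to $\mathfrak h$ is non-degenerate, and let $\mathfrak h^\perp$ be the $B$-orthogonal complement of $\mathfrak h$ in $\mathfrak g$. Let $g_G$ be the left-invariant field of bilinear forms on $G$ with value $B$ at $1$. In the same way, endomorphisms of $\mathfrak g$ are extended to left-invariant endomorphisms of $TG$. Definitions. A pseudo-Riemannian submersion $f:(M,g_M)\to(N,g_N)$ is a smooth submersion between pseudo-Riemannian manifolds such that $g_M$ is non-degenerate on the vertical spaces $\mathcal V=\ker f_*$ and $f_*$ is isometric on the horizontal spaces $\mathcal H=\mathcal V^\perp$; it is a Riemannian submersion if both metrics are positive definite. An endomorphism $J$ of a space with a symmetric bilinear form $\langle\cdot,\cdot\rangle$ is a *Hermitian complex structure* if $J^2=-\mathrm{id}$ and $\langle Jv,Jw\rangle=\langle v,w\rangle$, and a *Hermitian para-complex structure* if $J^2=\mathrm{id}$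 and $\langle Jv,Jw\rangle=-\langle v,w\rangle$. A *Hermitian quaternion structure* is a unital action of the quaternions with $\langle x\cdot v,x\cdot v\rangle=\|x\|^2\langle v,v\rangle$. A *Hermitian para-quaternion structure* is a unital action of the para-quaternions ($e_1^2=-1$, $e_2^2=e_3^2=1$, $e_1e_2=e_3=-e_2e_1$) for which $e_1$ acts as a Hermitian complex structure and $e_2,e_3$ act as Hermitian para-complex structures. On a manifold these structures are smooth fields of such structures on the tangent spaces. A Riemannian submersion (pseudo-Riemannian in the pseudo-Hermitian case; pseudo-Riemannian with a total space of neutral signature in the para cases) whose total space carries such a structure is *anti-invariant* (almost Hermitian, almost pseudo-Hermitian, quaternion, para-Hermitian, para-quaternion) if $J\mathcal V\subset\mathcal H$, respectively $x\cdot\mathcal V\subset\mathcal H$ for all purely imaginary $x$. It is *Lagrangian* if $J\mathcal V=\mathcal H$. Then $G/H$ (with the quotient topology) has a smooth manifold structure for which $\pi$ is a smooth submersion. For this structure there is a unique $G$-invariant field $g_{G/H}$ of bilinear forms on $G/H$ which corresponds, under $\pi_*$ at $1$, to the restriction of $B$ to $\mathfrak h^\perp$; the fields $g_G$ and $g_{G/H}$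 are pseudo-Riemannian metrics, and $\pi:(G,g_G)\to(G/H,g_{G/H})$ is a pseudo-Riemannian submersion. Moreover: 1. (Complex.) Let $J$ be a Hermitian complex structure on $(\mathfrak g,B)$ with $J\mathfrak h\subset\mathfrak h^\perp$. Then $\pi$ is an anti-invariant almost pseudo-Hermitian Riemannian submersion, and an anti-invariant almost Hermitian Riemannian submersion if $B$ is positive definite. It is Lagrangian if and only if $2\dim\mathfrak h=\dim\mathfrak g$. 2. (Quaternion.) Let $B$ be positive definite, and let a Hermitian quaternion structure on $(\mathfrak g,B)$ be given with $x\cdot\mathfrak h\subset\mathfrak h^\perp$ for every purely imaginary quaternion $x$. Then $\pi$ is an anti-invariant quaternion Riemannian submersion. 3. (Para-complex.) Let $B$ have neutral signature, and let $J$ be a Hermitian para-complex structure on $(\mathfrak g,B)$ with $J\mathfrak h\subset\mathfrak h^\perp$. Then $\pi$ is an anti-invariant para-Hermitian Riemannian submersion. It is Lagrangian if and only if $2\dim\mathfrak h=\dim\mathfrak g$. 4. (Para-quaternion.) Let $B$ have neutral signature, and let a Hermitian para-quaternion structure on $(\mathfrak g,B)$ be given with $x\cdot\mathfrak h\subset\mathfrak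 h^\perp$ for every purely imaginary para-quaternion $x$. Then $\pi$ is an anti-invariant para-quaternion Riemannian submersion. -/

import Mathlib

open scoped Manifold ContDiff Quaternion


noncomputable section

/-! ### Linear algebra: bilinear forms and Hermitian structures on a real vector space -/

section LinearLevel

variable {V : Type*} [AddCommGroup V] [Module ℝ V] [TopologicalSpace V]

/-- `B` is positive definite. -/
def FormPosDef (B : V →L[ℝ] V →L[ℝ] ℝ) : Prop :=
  ∀ v : V, v ≠ 0 → 0 < B v v

/-- `B` is symmetric. -/
def FormSymm (B : V →L[ℝ] V →L[ℝ] ℝ) : Prop :=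
  ∀ v w : V, B v w = B w v

/-- The restriction of `B` to the subspace `S` is non-degenerate. -/
def FormNondegenerateOn (B : V →L[ℝ] V →L[ℝ] ℝ) (S : Submodule ℝ V) : Prop :=
  ∀ v ∈ S, (∀ w ∈ S, B v w = 0) → v = 0

/-- `B` has neutral signature `(ℓ, ℓ)`: the space is a direct sum of a subspace on which `B` is
positive definite and one of the same dimension on which `B` is negative definite. -/
def FormNeutral (B : V →L[ℝ] V →L[ℝ] ℝ) : Prop :=
  ∃ P N : Submodule ℝ V, IsCompl P N ∧ Module.finrank ℝ P = Module.finrank ℝ N ∧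
    (∀ v ∈ P, v ≠ 0 → 0 < B v v) ∧ (∀ v ∈ N, v ≠ 0 → B v v < 0)

/-- The orthogonal complement of `S` with respect to `B`. -/
def formOrthogonal (B : V →L[ℝ] V →L[ℝ] ℝ) (S : Submodule ℝ V) : Submodule ℝ V where
  carrier := {w | ∀ v ∈ S, B v w = 0}
  zero_mem' := by intro v _; simp
  add_mem' := by
    intro a b ha hb v hv
    rw [map_add, ha v hv, hb v hv, add_zero]
  smul_mem' := by
    intro c a ha v hv
    rw [map_smul, ha v hv, smul_zero]

/-- `J` is a complex structure which is Hermitian with respect to `B`. -/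
structure IsHermitianComplex (B : V →L[ℝ] V →L[ℝ] ℝ) (J : V →L[ℝ] V) : Prop where
  sq : ∀ v, J (J v) = -v
  compat : ∀ v w, B (J v) (J w) = B v w

/-- `J` is a para-complex structure which is (para-)Hermitian with respect to `B`. -/
structure IsHermitianParaComplex (B : V →L[ℝ] V →L[ℝ] ℝ) (J : V →L[ℝ] V) : Prop where
  sq : ∀ v, J (J v) = v
  compat : ∀ v w, B (J v) (J w) = -B v w

/-- `ρ` is a unital (linear, associative) action of the real algebra `A` on `V`. -/
structure IsUnitalAction {A : Type*} [Ring A] [Algebra ℝ A] (ρ : A → V →L[ℝ] V) : Prop where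
  map_add : ∀ a b v, ρ (a + b) v = ρ a v + ρ b v
  map_smul : ∀ (c : ℝ) a v, ρ (c • a) v = c • ρ a v
  map_one : ∀ v, ρ 1 v = v
  map_mul : ∀ a b v, ρ (a * b) v = ρ a (ρ b v)

/-- A quaternion structure on `V` which is Hermitian with respect to `B`: a unital action of the
quaternions with `‖x • ξ‖² = ‖x‖² ‖ξ‖²`. -/
structure IsHermitianQuaternion (B : V →L[ℝ] V →L[ℝ] ℝ) (ρ : ℍ[ℝ] → V →L[ℝ] V) : Prop where
  action : IsUnitalAction ρ
  norm_sq : ∀ x v, B (ρ x v) (ρ x v) = ‖x‖ ^ 2 * B v v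

/-- The para-quaternions: `e₁² = -1`, `e₂² = e₃² = 1`, `e₁ e₂ = e₃ = -e₂ e₁`. -/
abbrev ParaQuaternion : Type := ℍ[ℝ, -1, 1]

/-- A para-quaternion structure on `V` which is Hermitian with respect to `B`: a unital action of
the para-quaternions for which `e₁` is Hermitian and `e₂`, `e₃` are para-Hermitian. -/
structure IsHermitianParaQuaternion (B : V →L[ℝ] V →L[ℝ] ℝ)
    (ρ : ParaQuaternion → V →L[ℝ] V) : Prop where
  action : IsUnitalAction ρ
  herm₁ : IsHermitianComplex B (ρ ⟨0, 1, 0, 0⟩)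
  herm₂ : IsHermitianParaComplex B (ρ ⟨0, 0, 1, 0⟩)
  herm₃ : IsHermitianParaComplex B (ρ ⟨0, 0, 0, 1⟩)

end LinearLevel

/-! ### Metrics, structures on the tangent bundle, and submersions -/

section Manifolds

variable {E : Type*} [NormedAddCommGroup E] [NormedSpace ℝ E]
  {K : Type*} [TopologicalSpace K] (I : ModelWithCorners ℝ E K)
  {M : Type*} [TopologicalSpace M] [ChartedSpace K M]
  {E' : Type*} [NormedAddCommGroup E'] [NormedSpace ℝ E']
  {K' : Type*} [TopologicalSpace K'] (I' : ModelWithCorners ℝ E' K')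
  {N : Type*} [TopologicalSpace N] [ChartedSpace K' N]

/-- `g` is a (smooth) pseudo-Riemannian metric. -/
structure IsPseudoRiemannianMetric [IsManifold I ∞ M]
    (g : ∀ x : M, TangentSpace I x →L[ℝ] TangentSpace I x →L[ℝ] ℝ) : Prop where
  symm : ∀ x, FormSymm (g x)
  nondegenerate : ∀ x, FormNondegenerateOn (g x) ⊤
  smooth : ContMDiff I (I.prod 𝓘(ℝ, E →L[ℝ] E →L[ℝ] ℝ)) ∞
    (fun x : M ↦ Bundle.TotalSpace.mk' (E →L[ℝ] E →L[ℝ] ℝ)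
      (E := fun x : M ↦ TangentSpace I x →L[ℝ] TangentSpace I x →L[ℝ] ℝ) x (g x))

/-- `J` is a smooth endomorphism of the tangent bundle. -/
def IsSmoothEndomorphism [IsManifold I ∞ M]
    (J : ∀ x : M, TangentSpace I x →L[ℝ] TangentSpace I x) : Prop :=
  ContMDiff I (I.prod 𝓘(ℝ, E →L[ℝ] E)) ∞
    (fun x : M ↦ Bundle.TotalSpace.mk' (E →L[ℝ] E)
      (E := fun x : M ↦ TangentSpace I x →L[ℝ] TangentSpace I x) x (J x))

/-- `f` is a smooth submersion. -/
structure IsSmoothSubmersion (f : M → N) : Prop where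
  smooth : ContMDiff I I' ∞ f
  surjective : ∀ x : M, Function.Surjective (mfderiv I I' f x)

/-- The vertical space of `f` at `x`. -/
def verticalSpace (f : M → N) (x : M) : Submodule ℝ (TangentSpace I x) :=
  LinearMap.ker (mfderiv I I' f x).toLinearMap

/-- The horizontal space of `f` at `x`: the orthogonal complement of the vertical space. -/
def horizontalSpace (g : ∀ x : M, TangentSpace I x →L[ℝ] TangentSpace I x →L[ℝ] ℝ)
    (f : M → N) (x : M) : Submodule ℝ (TangentSpace I x) :=
  formOrthogonal (g x) (verticalSpace I I' f x)

/-- `f : (M, gM) → (N, gN)` is a pseudo-Riemannian submersion. -/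
structure IsPseudoRiemannianSubmersion [IsManifold I ∞ M] [IsManifold I' ∞ N]
    (gM : ∀ x : M, TangentSpace I x →L[ℝ] TangentSpace I x →L[ℝ] ℝ)
    (gN : ∀ y : N, TangentSpace I' y →L[ℝ] TangentSpace I' y →L[ℝ] ℝ)
    (f : M → N) : Prop where
  metric_source : IsPseudoRiemannianMetric I gM
  metric_target : IsPseudoRiemannianMetric I' gN
  submersion : IsSmoothSubmersion I I' f
  vertical_nondegenerate : ∀ x, FormNondegenerateOn (gM x) (verticalSpace I I' f x)
  isometry : ∀ x, ∀ v ∈ horizontalSpace I I' gM f x, ∀ w ∈ horizontalSpace I I' gM f x,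
    gN (f x) (mfderiv I I' f x v) (mfderiv I I' f x w) = gM x v w

/-- `f : (M, gM) → (N, gN)` is a Riemannian submersion. -/
structure IsRiemannianSubmersion [IsManifold I ∞ M] [IsManifold I' ∞ N]
    (gM : ∀ x : M, TangentSpace I x →L[ℝ] TangentSpace I x →L[ℝ] ℝ)
    (gN : ∀ y : N, TangentSpace I' y →L[ℝ] TangentSpace I' y →L[ℝ] ℝ)
    (f : M → N) : Prop extends IsPseudoRiemannianSubmersion I I' gM gN f where
  posDef_source : ∀ x, FormPosDef (gM x)
  posDef_target : ∀ y, FormPosDef (gN y)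

/-- `J` maps the vertical distribution into the horizontal one. -/
def MapsVerticalToHorizontal (gM : ∀ x : M, TangentSpace I x →L[ℝ] TangentSpace I x →L[ℝ] ℝ)
    (J : ∀ x : M, TangentSpace I x →L[ℝ] TangentSpace I x) (f : M → N) : Prop :=
  ∀ x, ∀ v ∈ verticalSpace I I' f x, J x v ∈ horizontalSpace I I' gM f x

/-- `J` maps the vertical distribution onto the horizontal one (the Lagrangian condition). -/
def IsLagrangian (gM : ∀ x : M, TangentSpace I x →L[ℝ] TangentSpace I x →L[ℝ] ℝ)
    (J : ∀ x : M, TangentSpace I x →L[ℝ] TangentSpace I x) (f : M → N) : Prop :=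
  ∀ x, (verticalSpace I I' f x).map (J x).toLinearMap = horizontalSpace I I' gM f x

/-- `f` is an anti-invariant almost pseudo-Hermitian Riemannian submersion. -/
structure IsAntiInvariantAlmostPseudoHermitian [IsManifold I ∞ M] [IsManifold I' ∞ N]
    (gM : ∀ x : M, TangentSpace I x →L[ℝ] TangentSpace I x →L[ℝ] ℝ)
    (gN : ∀ y : N, TangentSpace I' y →L[ℝ] TangentSpace I' y →L[ℝ] ℝ)
    (J : ∀ x : M, TangentSpace I x →L[ℝ] TangentSpace I x) (f : M → N) : Prop where
  submersion : IsPseudoRiemannianSubmersion I I' gM gN f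
  smooth : IsSmoothEndomorphism I J
  hermitian : ∀ x, IsHermitianComplex (gM x) (J x)
  antiInvariant : MapsVerticalToHorizontal I I' gM J f

/-- `f` is an anti-invariant almost Hermitian Riemannian submersion. -/
structure IsAntiInvariantAlmostHermitian [IsManifold I ∞ M] [IsManifold I' ∞ N]
    (gM : ∀ x : M, TangentSpace I x →L[ℝ] TangentSpace I x →L[ℝ] ℝ)
    (gN : ∀ y : N, TangentSpace I' y →L[ℝ] TangentSpace I' y →L[ℝ] ℝ)
    (J : ∀ x : M, TangentSpace I x →L[ℝ] TangentSpace I x) (f : M → N) : Prop where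
  submersion : IsRiemannianSubmersion I I' gM gN f
  smooth : IsSmoothEndomorphism I J
  hermitian : ∀ x, IsHermitianComplex (gM x) (J x)
  antiInvariant : MapsVerticalToHorizontal I I' gM J f

/-- `f` is an anti-invariant quaternion Riemannian submersion, for the flat quaternion structure
`ρ` on `M`. -/
structure IsAntiInvariantQuaternion [IsManifold I ∞ M] [IsManifold I' ∞ N]
    (gM : ∀ x : M, TangentSpace I x →L[ℝ] TangentSpace I x →L[ℝ] ℝ)
    (gN : ∀ y : N, TangentSpace I' y →L[ℝ] TangentSpace I' y →L[ℝ] ℝ)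
    (ρ : ∀ x : M, ℍ[ℝ] → TangentSpace I x →L[ℝ] TangentSpace I x) (f : M → N) : Prop where
  submersion : IsRiemannianSubmersion I I' gM gN f
  smooth : ∀ q : ℍ[ℝ], IsSmoothEndomorphism I (fun x ↦ ρ x q)
  hermitian : ∀ x, IsHermitianQuaternion (gM x) (ρ x)
  antiInvariant : ∀ q : ℍ[ℝ], q.re = 0 → MapsVerticalToHorizontal I I' gM (fun x ↦ ρ x q) f

/-- `f` is an anti-invariant para-Hermitian Riemannian submersion. -/
structure IsAntiInvariantParaHermitian [IsManifold I ∞ M] [IsManifold I' ∞ N]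
    (gM : ∀ x : M, TangentSpace I x →L[ℝ] TangentSpace I x →L[ℝ] ℝ)
    (gN : ∀ y : N, TangentSpace I' y →L[ℝ] TangentSpace I' y →L[ℝ] ℝ)
    (J : ∀ x : M, TangentSpace I x →L[ℝ] TangentSpace I x) (f : M → N) : Prop where
  submersion : IsPseudoRiemannianSubmersion I I' gM gN f
  neutral : ∀ x, FormNeutral (gM x)
  smooth : IsSmoothEndomorphism I J
  hermitian : ∀ x, IsHermitianParaComplex (gM x) (J x)
  antiInvariant : MapsVerticalToHorizontal I I' gM J f

/-- `f` is an anti-invariant para-quaternion Riemannian submersion, for the flat para-quaternion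
structure `ρ` on `M`. -/
structure IsAntiInvariantParaQuaternion [IsManifold I ∞ M] [IsManifold I' ∞ N]
    (gM : ∀ x : M, TangentSpace I x →L[ℝ] TangentSpace I x →L[ℝ] ℝ)
    (gN : ∀ y : N, TangentSpace I' y →L[ℝ] TangentSpace I' y →L[ℝ] ℝ)
    (ρ : ∀ x : M, ParaQuaternion → TangentSpace I x →L[ℝ] TangentSpace I x)
    (f : M → N) : Prop where
  submersion : IsPseudoRiemannianSubmersion I I' gM gN f
  neutral : ∀ x, FormNeutral (gM x)
  smooth : ∀ q : ParaQuaternion, IsSmoothEndomorphism I (fun x ↦ ρ x q)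
  hermitian : ∀ x, IsHermitianParaQuaternion (gM x) (ρ x)
  antiInvariant : ∀ q : ParaQuaternion, q.re = 0 →
    MapsVerticalToHorizontal I I' gM (fun x ↦ ρ x q) f

end Manifolds

/-! ### Lie groups, subgroups and coset spaces -/

section LieGroups

variable {E : Type*} [NormedAddCommGroup E] [NormedSpace ℝ E]
  {K : Type*} [TopologicalSpace K] (I : ModelWithCorners ℝ E K)
  {G : Type*} [TopologicalSpace G] [ChartedSpace K G] [Group G]

/-- The differential at `1` of left translation by `x`. -/
def leftDeriv (x : G) : GroupLieAlgebra I G →L[ℝ] TangentSpace I x :=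
  mfderiv I I (fun y : G ↦ x * y) 1

/-- The differential at `x` of left translation by `x⁻¹`. -/
def leftDerivInv (x : G) : TangentSpace I x →L[ℝ] GroupLieAlgebra I G :=
  mfderiv I I (fun y : G ↦ x⁻¹ * y) x

/-- The adjoint action: the differential at `1` of conjugation by `x`. -/
def lieAd (x : G) : GroupLieAlgebra I G →L[ℝ] GroupLieAlgebra I G :=
  mfderiv I I (fun y : G ↦ x * y * x⁻¹) 1

/-- The left-invariant field of bilinear forms with value `B` at `1`. -/
def leftInvariantForm (B : GroupLieAlgebra I G →L[ℝ] GroupLieAlgebra I G →L[ℝ] ℝ) (x : G) :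
    TangentSpace I x →L[ℝ] TangentSpace I x →L[ℝ] ℝ :=
  (ContinuousLinearMap.precomp ℝ (leftDerivInv I x)).comp (B.comp (leftDerivInv I x))

/-- The left-invariant field of endomorphisms with value `J` at `1`. -/
def leftInvariantEndo (J : GroupLieAlgebra I G →L[ℝ] GroupLieAlgebra I G) (x : G) :
    TangentSpace I x →L[ℝ] TangentSpace I x :=
  (leftDeriv I x).comp (J.comp (leftDerivInv I x))

/-- `B` is invariant under the adjoint action of `H`. -/
def AdInvariant (H : Subgroup G) (B : GroupLieAlgebra I G →L[ℝ] GroupLieAlgebra I G →L[ℝ] ℝ) :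
    Prop :=
  ∀ h ∈ H, ∀ v w, B (lieAd I h v) (lieAd I h w) = B v w

/-- The Lie algebra `𝔥 ⊆ 𝔤` of a closed subgroup `H` of `G`, as a subspace of `𝔤 = T₁G`: the
velocities at `1` of the smooth curves of `G` which run in `H` and pass through `1` at time `0`. -/
def subgroupLieAlgebra [LieGroup I ∞ G] (H : Subgroup G) :
    Submodule ℝ (GroupLieAlgebra I G) where
  carrier := {v | ∃ c : ℝ → G, ContMDiff 𝓘(ℝ, ℝ) I ∞ c ∧ c 0 = 1 ∧ (∀ t, c t ∈ H) ∧
    (mfderiv 𝓘(ℝ, ℝ) I c 0 (1 : ℝ) : E) = v}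
  zero_mem' := by
    refine ⟨fun _ ↦ 1, contMDiff_const, rfl, fun _ ↦ H.one_mem, ?_⟩
    rw [mfderiv_const]
    rfl
  add_mem' := by
    rintro v w ⟨c, hc, hc0, hcH, hcv⟩ ⟨d, hd, hd0, hdH, hdw⟩
    have ne : (∞ : ℕ∞ω) ≠ 0 := by simp
    refine ⟨fun t ↦ c t * d t, hc.mul hd, by simp [hc0, hd0], fun t ↦ H.mul_mem (hcH t) (hdH t), ?_⟩
    have hm : MDifferentiableAt (I.prod I) I (fun p : G × G ↦ p.1 * p.2) (1, 1) :=
      (contMDiff_mul I ∞).mdifferentiableAt ne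
    have hcd : MDifferentiableAt 𝓘(ℝ, ℝ) (I.prod I) (fun t ↦ (c t, d t)) 0 :=
      (hc.prodMk hd).mdifferentiableAt ne
    have e1 := mfderiv_comp_apply_of_eq (0 : ℝ) hm hcd (by simp [hc0, hd0]) (1 : ℝ)
    have e2 := DFunLike.congr_fun
      ((hc.mdifferentiableAt ne (x := 0)).mfderiv_prod (hd.mdifferentiableAt ne)) (1 : ℝ)
    have e3 : ∀ p : E × E, mfderiv (I.prod I) I (fun p : G × G ↦ p.1 * p.2) (1, 1) p =
        (p.1 + p.2 : E) := by
      intro p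
      refine (mfderiv_prod_eq_add_apply (p := ((1 : G), (1 : G))) hm).trans ?_
      have r : (fun z : G ↦ z * 1) = id := by ext; simp
      have l : (fun z : G ↦ 1 * z) = id := by ext; simp
      have r' : ∀ v : E, mfderiv I I (fun z : G ↦ z * 1) 1 v = v := by
        intro v; rw [r, mfderiv_id]; rfl
      have l' : ∀ v : E, mfderiv I I (fun z : G ↦ 1 * z) 1 v = v := by
        intro v; rw [l, mfderiv_id]; rfl
      exact congrArg₂ (fun a b : E ↦ a + b) (r' p.1) (l' p.2)
    refine e1.trans ((congrArg _ e2).trans ((e3 _).trans ?_))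
    exact congrArg₂ (fun a b : E ↦ a + b) hcv hdw
  smul_mem' := by
    rintro a v ⟨c, hc, hc0, hcH, hcv⟩
    have hm : ContMDiff 𝓘(ℝ, ℝ) 𝓘(ℝ, ℝ) ∞ (fun t : ℝ ↦ a * t) :=
      (contDiff_const.mul contDiff_id).contMDiff
    have ne : (∞ : ℕ∞ω) ≠ 0 := by simp
    refine ⟨fun t ↦ c (a * t), hc.comp hm, by simp [hc0], fun t ↦ hcH _, ?_⟩
    have e1 := mfderiv_comp_apply_of_eq (0 : ℝ) (hc.mdifferentiableAt ne)
      (hm.mdifferentiableAt ne) (mul_zero a) (1 : ℝ)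
    have e2 : mfderiv 𝓘(ℝ, ℝ) 𝓘(ℝ, ℝ) (fun t : ℝ ↦ a * t) 0 (1 : ℝ) = (a • (1 : ℝ) : ℝ) := by
      have h : HasFDerivAt (fun t : ℝ ↦ a * t) (a • ContinuousLinearMap.id ℝ ℝ) 0 :=
        (hasFDerivAt_id (0 : ℝ)).const_mul a
      exact DFunLike.congr_fun h.hasMFDerivAt.mfderiv (1 : ℝ)
    refine e1.trans ((congrArg _ e2).trans ?_)
    refine ((mfderiv 𝓘(ℝ, ℝ) I c 0).map_smul a (1 : ℝ)).trans ?_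
    exact congrArg (fun x : E ↦ a • x) hcv

/-- `g` is the `G`-invariant field of bilinear forms on `G ⧸ H` which corresponds to the restriction
of `B` to `𝔥^⊥`, by the differential at `1` of the projection `G → G ⧸ H`. -/
structure IsInducedMetric [LieGroup I ∞ G] (H : Subgroup G)
    (B : GroupLieAlgebra I G →L[ℝ] GroupLieAlgebra I G →L[ℝ] ℝ)
    {E' : Type*} [NormedAddCommGroup E'] [NormedSpace ℝ E']
    {K' : Type*} [TopologicalSpace K'] (I' : ModelWithCorners ℝ E' K')
    [ChartedSpace K' (G ⧸ H)]
    (g : ∀ p : G ⧸ H, TangentSpace I' p →L[ℝ] TangentSpace I' p →L[ℝ] ℝ) : Prop where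
  base : ∀ v ∈ formOrthogonal B (subgroupLieAlgebra I H),
    ∀ w ∈ formOrthogonal B (subgroupLieAlgebra I H),
    g ((1 : G) : G ⧸ H) (mfderiv I I' (fun x : G ↦ (x : G ⧸ H)) 1 v)
      (mfderiv I I' (fun x : G ↦ (x : G ⧸ H)) 1 w) = B v w
  invariant : ∀ (a : G) (p : G ⧸ H) (v w : TangentSpace I' p),
    g (a • p) (mfderiv I' I' (fun q : G ⧸ H ↦ a • q) p v)
      (mfderiv I' I' (fun q : G ⧸ H ↦ a • q) p w) = g p v w

end LieGroups

end

/-!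
The proof has two parts: the smooth structure of `G ⧸ H`, with the description of the kernel of the
differential of the projection, and the invariant geometry, which is then a matter of linear
algebra on the Lie algebra `𝔤` of `G`.

**The coset space.** The closed subgroup theorem is obtained without the exponential map. A vector
`y ∈ 𝔤` is *subtangent* to `H` if it is a limit of difference quotients, in the chart at `1`, of
points of `H` with positive step sizes. By left translation, the left-invariant vector field of `y`
is then subtangent to `H` at all points of `H`, and so is its negative. Nagumo's invariance theorem
(`mem_of_isSubtangent`, a Grönwall estimate for the distance to `H`) shows that the integral curve
through `1` stays in the closed set `H`. Hence `y` is in the Lie algebra `𝔥` of `H`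
(`mem_subgroupLieAlgebra_of_isSubtangent`).

By compactness of the unit sphere, a slice through `1` in a direction complementary to `𝔥` meets
`H` near `1` only in `1` (`eventually_eq_zero_of_mem`). With the inverse function theorem, applied
to the product of the slice with a smooth family of elements of `H`, this gives a local
cross-section of the cosets (`exists_localCrossSection`). Its translates are an atlas of `G ⧸ H`
for which the projection is a smooth submersion (`exists_isSmoothSubmersion_mk`).

For any smooth structure for which the projection `π` is a submersion, `π` has smooth local
sections. So `G` acts smoothly on `G ⧸ H`, and the kernel of `dπ` at `1` is `𝔥`
(`mfderiv_mk_eq_zero_iff`): a section moves a curve with velocity in the kernel into `H` without a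
change of the velocity.

**The metric.** Let `B₀` be the form on `𝔤` which agrees with `B` on `𝔥^⊥` and has `𝔥` in its
radical (`IsHorizontalPart`). It is `Ad(H)`-invariant, since `Ad(H)` preserves `𝔥`, `B`, and hence
`𝔥^⊥`. So the left-invariant field with value `B₀` takes the same values on tangent vectors with
the same images under `dπ`, and is the pull-back of a field `g` on `G ⧸ H`
(`exists_pullback_eq_leftInvariantForm`). All properties of `g` are read from this pull-back: `g`
is invariant, non-degenerate because the radical of `B₀` is exactly `𝔥`, and smooth because it is
locally the pull-back of `B₀` by the differentials of the maps `q ↦ (τ p)⁻¹ * τ q`, for a local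
section `τ` (`contMDiff_of_pullback_eq_leftInvariantForm`). Every invariant field which corresponds
to `B` on `𝔥^⊥` has the same pull-back, which gives uniqueness.

**The structures.** Left translation carries `(𝔥, 𝔥^⊥)` to the vertical and horizontal spaces
(`mem_verticalSpace_mk`, `mem_horizontalSpace_mk`) and Hermitian structures on `𝔤` to Hermitian
structures on the tangent spaces. So anti-invariance can be checked in `𝔤`, and the Lagrangian
condition `J 𝔥 = 𝔥^⊥` becomes an equality of dimensions, because `J` is injective and `dim 𝔥^⊥ =
dim 𝔤 - dim 𝔥`.

The tangent spaces of a manifold are copies of its model space. Where base points are equal but not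
definitionally so, values of differentials are therefore compared in the model spaces `E` and `F`.
-/

noncomputable section

open Set Filter Topology Metric

/-! ### Invariance of closed sets under flows -/

section Invariance

variable {E : Type*} [NormedAddCommGroup E] [NormedSpace ℝ E]

/-- The vector `w` is subtangent to `S` at `p`: it is a limit of difference quotients of points of
`S`, along step sizes tending to `0` from the right. -/
def IsSubtangent (S : Set E) (p w : E) : Prop :=
  ∃ (q : ℕ → E) (τ : ℕ → ℝ), (∀ n, 0 < τ n) ∧ Tendsto τ atTop (𝓝 0) ∧ (∀ᶠ n in atTop, q n ∈ S) ∧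
    Tendsto (fun n ↦ (τ n)⁻¹ • (q n - p)) atTop (𝓝 w)

/-- Nagumo's invariance theorem: an integral curve of a Lipschitz vector field which is subtangent
to a closed set `S` at the points of `S` does not leave `S`. The distance to `S` satisfies the
hypothesis of Grönwall's lemma: compare the curve with the difference quotients at a nearest
point of `S`. -/
theorem mem_of_isSubtangent [ProperSpace E] {S : Set E} (hS : IsClosed S) {v : E → E} {C : NNReal}
    {x₀ : E} {r : ℝ} (hx₀ : x₀ ∈ S) (hv : LipschitzOnWith C v (ball x₀ r))
    (hsub : ∀ p ∈ S ∩ ball x₀ r, IsSubtangent S p (v p)) {x : ℝ → E} {T : ℝ}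
    (hxd : ∀ t ∈ Icc 0 T, HasDerivAt x (v (x t)) t) (hx0 : x 0 = x₀)
    (hxr : ∀ t ∈ Icc 0 T, x t ∈ ball x₀ (r / 2)) : ∀ t ∈ Icc 0 T, x t ∈ S := by
  have hne : S.Nonempty := ⟨x₀, hx₀⟩
  have key := le_gronwallBound_of_liminf_deriv_right_le (f := fun t ↦ infDist (x t) S)
    (f' := fun t ↦ C * infDist (x t) S) (δ := 0) (K := C) (ε := 0) (a := 0) (b := T)
    (fun t ht ↦ ((continuous_infDist_pt S).continuousAt.comp
      (hxd t ht).continuousAt).continuousWithinAt) ?_ (by simp [hx0, infDist_zero_of_mem hx₀])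
    (fun t _ ↦ by simp)
  · intro t ht
    have h := key t ht
    rw [gronwallBound_ε0_δ0] at h
    exact (hS.mem_iff_infDist_zero hne).2 (le_antisymm h infDist_nonneg)
  intro t ht c hc
  have ht' : t ∈ Icc 0 T := ⟨ht.1, ht.2.le⟩
  obtain ⟨p, hpS, hp⟩ := hS.exists_infDist_eq_dist hne (x t)
  have hxt := mem_ball.1 (hxr t ht')
  have hr : dist p x₀ < r := by
    have h1 : dist (x t) p ≤ dist (x t) x₀ := hp ▸ infDist_le_dist_of_mem hx₀
    have h2 := dist_triangle_left p x₀ (x t)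
    linarith
  obtain ⟨q, τ, hτ, hτ0, hq, hlim⟩ := hsub p ⟨hpS, hr⟩
  have hd : Tendsto (fun n ↦ (τ n)⁻¹ • (x (t + τ n) - x t)) atTop (𝓝 (v (x t))) := by
    have h := (hasDerivAt_iff_tendsto_slope_zero.1 (hxd t ht')).comp
      (tendsto_nhdsWithin_iff.2 ⟨hτ0, Eventually.of_forall fun n ↦ (hτ n).ne'⟩)
    exact h
  have hlt : ‖v (x t) - v p‖ < c := by
    refine lt_of_le_of_lt ?_ hc
    have := hv.dist_le_mul (x t) (mem_ball.2 (by linarith [dist_nonneg (x := x t) (y := x₀)]))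
      p (mem_ball.2 hr)
    rw [dist_eq_norm] at this
    rwa [hp]
  have hev : ∀ᶠ n in atTop,
      (t + τ n - t)⁻¹ * (infDist (x (t + τ n)) S - infDist (x t) S) < c := by
    filter_upwards [(hd.sub hlim).norm.eventually (gt_mem_nhds hlt), hq] with n hn hqn
    refine lt_of_le_of_lt ?_ hn
    rw [← smul_sub, norm_smul, add_sub_cancel_left, norm_inv, Real.norm_of_nonneg (hτ n).le]
    refine mul_le_mul_of_nonneg_left ?_ (inv_nonneg.2 (hτ n).le)
    have h1 := infDist_le_dist_of_mem (x := x (t + τ n)) hqn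
    rw [hp, dist_eq_norm]
    rw [dist_eq_norm] at h1
    have h2 := norm_add_le (x (t + τ n) - x t - (q n - p)) (x t - p)
    have h3 : x (t + τ n) - x t - (q n - p) + (x t - p) = x (t + τ n) - q n := by abel
    rw [h3] at h2
    linarith
  have htend : Tendsto (fun n ↦ t + τ n) atTop (𝓝[>] t) :=
    tendsto_nhdsWithin_iff.2 ⟨by simpa using tendsto_const_nhds.add hτ0,
      Eventually.of_forall fun n ↦ by simpa using hτ n⟩
  exact htend.frequently hev.frequently

/-- If both `v` and `-v` are subtangent to the closed set `S` at its points near `x₀`, then `S`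
contains a smooth curve through `x₀` with velocity `v x₀`. -/
theorem exists_smooth_curve_of_isSubtangent [ProperSpace E] {S : Set E} (hS : IsClosed S)
    {v : E → E} {x₀ : E} {r : ℝ} (hr : 0 < r) (hx₀ : x₀ ∈ S) (hv : ContDiffOn ℝ ∞ v (ball x₀ r))
    (hpos : ∀ p ∈ S ∩ ball x₀ r, IsSubtangent S p (v p))
    (hneg : ∀ p ∈ S ∩ ball x₀ r, IsSubtangent S p (-v p)) :
    ∃ c : ℝ → E, ContDiff ℝ ∞ c ∧ c 0 = x₀ ∧ HasDerivAt c (v x₀) 0 ∧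
      ∀ t, c t ∈ S ∩ ball x₀ r := by
  have hv1 : ContDiffAt ℝ 1 v x₀ :=
    (hv.contDiffAt (ball_mem_nhds x₀ hr)).of_le (by exact_mod_cast le_top)
  obtain ⟨C, s, hs, hC⟩ := hv1.exists_lipschitzOnWith
  obtain ⟨r₁, hr₁, hr₁s⟩ := Metric.mem_nhds_iff.1 hs
  obtain ⟨x, hx0, ε, hε, hxd⟩ :=
    hv1.exists_forall_mem_closedBall_exists_eq_forall_mem_Ioo_hasDerivAt₀ 0
  simp only [zero_sub, zero_add] at hxd
  set ρ := min r r₁ with hρ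
  have hρ0 : 0 < ρ := lt_min hr hr₁
  have hcont : x ⁻¹' ball x₀ (ρ / 2) ∈ 𝓝 (0 : ℝ) := by
    refine (hxd 0 ⟨by linarith, hε⟩).continuousAt.preimage_mem_nhds ?_
    rw [hx0]
    exact ball_mem_nhds _ (half_pos hρ0)
  obtain ⟨δ, hδ, hδx⟩ := Metric.mem_nhds_iff.1 hcont
  set T := min (ε / 2) (δ / 2) with hTdef
  have hT : 0 < T := lt_min (half_pos hε) (half_pos hδ)
  have hTε : T < ε := (min_le_left _ _).trans_lt (half_lt_self hε)
  have hTδ : T < δ := (min_le_right _ _).trans_lt (half_lt_self hδ)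
  have hxball : ∀ t ∈ Icc (-T) T, x t ∈ ball x₀ (ρ / 2) := fun t ht ↦ hδx (by
    rw [mem_ball_zero_iff, Real.norm_eq_abs, abs_lt]
    constructor <;> linarith [ht.1, ht.2])
  have hsubset : ball x₀ ρ ⊆ ball x₀ r := ball_subset_ball (min_le_left _ _)
  have hlip : LipschitzOnWith C v (ball x₀ ρ) :=
    hC.mono ((ball_subset_ball (min_le_right _ _)).trans hr₁s)
  have hxpos : ∀ t ∈ Icc 0 T, x t ∈ S :=
    mem_of_isSubtangent hS hx₀ hlip (fun p hp ↦ hpos p ⟨hp.1, hsubset hp.2⟩)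
      (fun t ht ↦ hxd t ⟨by linarith [ht.1], by linarith [ht.2]⟩) hx0
      (fun t ht ↦ hxball t ⟨by linarith [ht.1], ht.2⟩)
  have hxneg : ∀ t ∈ Icc 0 T, x (-t) ∈ S := by
    refine mem_of_isSubtangent (v := fun p ↦ -v p) (x := fun t ↦ x (-t)) hS hx₀ (C := C)
      (r := ρ) ?_ (fun p hp ↦ hneg p ⟨hp.1, hsubset hp.2⟩) ?_ (by simpa using hx0)
      (fun t ht ↦ hxball (-t) ⟨by linarith [ht.2], by linarith [ht.1]⟩)
    · refine LipschitzOnWith.of_dist_le_mul fun p hp q hq ↦ ?_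
      rw [dist_neg_neg]
      exact hlip.dist_le_mul p hp q hq
    · intro t ht
      have h := (hxd (-t) ⟨by linarith [ht.2], by linarith [ht.1]⟩).scomp t (hasDerivAt_neg t)
      simpa [Function.comp_def] using h
  have hxS : ∀ t ∈ Icc (-T) T, x t ∈ S := by
    intro t ht
    rcases le_total 0 t with h | h
    · exact hxpos t ⟨h, ht.2⟩
    · simpa using hxneg (-t) ⟨by linarith, by linarith [ht.1]⟩
  have hxsm : ContDiffOn ℝ ∞ x (Icc (-T) T) := by
    refine ODE.contDiffOn_enat_Icc_of_hasDerivWithinAt (n := ⊤) (f := fun _ ↦ v) (u := ball x₀ r)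
      (hv.comp contDiffOn_snd fun p hp ↦ hp.2) (fun t ht ↦ (hxd t ⟨by linarith [ht.1],
      by linarith [ht.2]⟩).hasDerivWithinAt) fun t ht ↦ ?_
    exact hsubset (ball_subset_ball (by linarith) (hxball t ht))
  -- the time change `t ↦ (T / 2) sin (2 t / T)` is bounded and has derivative `1` at `0`
  have hsin : ∀ t : ℝ, T / 2 * Real.sin ((T / 2)⁻¹ * t) ∈ Icc (-T) T := by
    intro t
    have h1 := Real.neg_one_le_sin ((T / 2)⁻¹ * t)
    have h2 := Real.sin_le_one ((T / 2)⁻¹ * t)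
    constructor <;> nlinarith
  have hsinsm : ContDiff ℝ ∞ fun t : ℝ ↦ T / 2 * Real.sin ((T / 2)⁻¹ * t) :=
    contDiff_const.mul (Real.contDiff_sin.comp (contDiff_const.mul contDiff_id))
  refine ⟨fun t ↦ x (T / 2 * Real.sin ((T / 2)⁻¹ * t)), ?_, by simp [hx0], ?_, fun t ↦ ?_⟩
  · rw [← contDiffOn_univ]
    exact hxsm.comp hsinsm.contDiffOn fun t _ ↦ hsin t
  · have h1 : HasDerivAt (fun t : ℝ ↦ T / 2 * Real.sin ((T / 2)⁻¹ * t)) 1 0 := by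
      have h := (((hasDerivAt_id (0 : ℝ)).const_mul (T / 2)⁻¹).sin).const_mul (T / 2)
      convert! h using 1
      simp [hT.ne']
    have h2 : HasDerivAt x (v x₀) (T / 2 * Real.sin ((T / 2)⁻¹ * 0)) := by
      have := hxd 0 ⟨by linarith, hε⟩
      rw [hx0] at this
      simpa using this
    simpa [Function.comp_def] using h2.scomp (0 : ℝ) h1
  · have h := hsin t
    exact ⟨hxS _ h, hsubset (ball_subset_ball (by linarith) (hxball _ h))⟩

end Invariance

section Subtangent

variable {E : Type*} [NormedAddCommGroup E] [NormedSpace ℝ E]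
  {F : Type*} [NormedAddCommGroup F] [NormedSpace ℝ F]

theorem tendsto_of_tendsto_inv_smul_sub {p w : E} {q : ℕ → E} {τ : ℕ → ℝ} (hτ : ∀ n, 0 < τ n)
    (hτ0 : Tendsto τ atTop (𝓝 0))
    (hlim : Tendsto (fun n ↦ (τ n)⁻¹ • (q n - p)) atTop (𝓝 w)) : Tendsto q atTop (𝓝 p) := by
  have h := (hτ0.smul hlim).add_const p
  simp only [zero_smul, zero_add] at h
  refine h.congr fun n ↦ ?_
  rw [smul_inv_smul₀ (hτ n).ne', sub_add_cancel]

/-- A differentiable map sends subtangent vectors to subtangent vectors. -/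
theorem IsSubtangent.map {S : Set E} {S' : Set F} {p w : E} (h : IsSubtangent S p w) {f : E → F}
    {f' : E →L[ℝ] F} (hf : HasFDerivAt f f' p) (hmaps : ∀ᶠ q in 𝓝 p, q ∈ S → f q ∈ S') :
    IsSubtangent S' (f p) (f' w) := by
  obtain ⟨q, τ, hτ, hτ0, hq, hlim⟩ := h
  have hqp := tendsto_of_tendsto_inv_smul_sub hτ hτ0 hlim
  refine ⟨fun n ↦ f (q n), τ, hτ, hτ0, ?_, ?_⟩
  · filter_upwards [hqp.eventually hmaps, hq] with n h1 h2 using h1 h2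
  · have hqp0 : Tendsto (fun n ↦ q n - p) atTop (𝓝 0) := by simpa using hqp.sub_const p
    simpa using (hasFDerivWithinAt_univ.2 hf).lim hqp0 (Eventually.of_forall fun n ↦ mem_univ _)
      hlim

theorem IsSubtangent.mono {S S' : Set E} {p w : E} (h : IsSubtangent S p w)
    (hS : ∀ᶠ q in 𝓝 p, q ∈ S → q ∈ S') : IsSubtangent S' p w :=
  h.map (f := id) (hasFDerivAt_id p) hS

end Subtangent

/-! ### The group law in the chart at the identity -/

section Chart

variable {E : Type*} [NormedAddCommGroup E] [NormedSpace ℝ E]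
  {K : Type*} [TopologicalSpace K] (I : ModelWithCorners ℝ E K)
  {M : Type*} [TopologicalSpace M] [ChartedSpace K M]
  {F : Type*} [NormedAddCommGroup F] [NormedSpace ℝ F]

theorem hasMFDerivAt_of_extChartAt_comp {f : F → M} {x : F} {f' : F →L[ℝ] E}
    (hc : ContinuousAt f x) (hf : HasFDerivAt (fun y ↦ extChartAt I (f x) (f y)) f' x) :
    HasMFDerivAt 𝓘(ℝ, F) I f x f' := by
  exact ⟨hc, hf.hasFDerivWithinAt⟩

variable {G : Type*} [TopologicalSpace G] [ChartedSpace K G] [Group G]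

variable (G) in
/-- The multiplication of `G`, read in the chart at `1`. -/
def chartMul (p : E × E) : E :=
  extChartAt I (1 : G) ((extChartAt I (1 : G)).symm p.1 * (extChartAt I (1 : G)).symm p.2)

variable (G) in
/-- The inversion of `G`, read in the chart at `1`. -/
def chartInv (a : E) : E :=
  extChartAt I (1 : G) ((extChartAt I (1 : G)).symm a)⁻¹

/-- The part of a subgroup in the domain of the chart at `1`, read in this chart. -/
def chartSubgroup (H : Subgroup G) : Set E :=
  {a | a ∈ (extChartAt I (1 : G)).target ∧ (extChartAt I (1 : G)).symm a ∈ H}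

theorem extChartAt_one_symm_apply : (extChartAt I (1 : G)).symm (extChartAt I (1 : G) 1) = 1 :=
  (extChartAt I (1 : G)).left_inv (mem_extChartAt_source 1)

theorem chartMul_one_right {a : E} (h : a ∈ (extChartAt I (1 : G)).target) :
    chartMul I G (a, extChartAt I (1 : G) 1) = a := by
  rw [chartMul, extChartAt_one_symm_apply, mul_one, (extChartAt I (1 : G)).right_inv h]

theorem chartMul_one_left {a : E} (h : a ∈ (extChartAt I (1 : G)).target) :
    chartMul I G (extChartAt I (1 : G) 1, a) = a := by
  rw [chartMul, extChartAt_one_symm_apply, one_mul, (extChartAt I (1 : G)).right_inv h]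

variable [I.Boundaryless]

theorem extChartAt_symm_contMDiffAt [IsManifold I ∞ M] {x : M} {a : E}
    (ha : a ∈ (extChartAt I x).target) : ContMDiffAt 𝓘(ℝ, E) I ∞ (extChartAt I x).symm a :=
  (contMDiffOn_extChartAt_symm x).contMDiffAt ((isOpen_extChartAt_target x).mem_nhds ha)

theorem extChartAt_target_mem_nhds_one :
    (extChartAt I (1 : G)).target ∈ 𝓝 (extChartAt I (1 : G) 1) :=
  extChartAt_target_mem_nhds 1

theorem chartMul_contDiffAt [LieGroup I ∞ G] {p : E × E} (h1 : p.1 ∈ (extChartAt I (1 : G)).target)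
    (h2 : p.2 ∈ (extChartAt I (1 : G)).target)
    (h : (extChartAt I (1 : G)).symm p.1 * (extChartAt I (1 : G)).symm p.2 ∈
      (extChartAt I (1 : G)).source) : ContDiffAt ℝ ∞ (chartMul I G) p := by
  rw [← contMDiffAt_iff_contDiffAt]
  have e1 : ContMDiffAt 𝓘(ℝ, E × E) I ∞ (fun p : E × E ↦ (extChartAt I (1 : G)).symm p.1) p :=
    (extChartAt_symm_contMDiffAt I h1).comp p contDiff_fst.contMDiff.contMDiffAt
  have e2 : ContMDiffAt 𝓘(ℝ, E × E) I ∞ (fun p : E × E ↦ (extChartAt I (1 : G)).symm p.2) p :=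
    (extChartAt_symm_contMDiffAt I h2).comp p contDiff_snd.contMDiff.contMDiffAt
  rw [extChartAt_source] at h
  exact (contMDiffAt_extChartAt' h).comp p (e1.mul e2)

variable [LieGroup I ∞ G]

theorem chartMul_contDiffAt_one_right {a : E} (h : a ∈ (extChartAt I (1 : G)).target) :
    ContDiffAt ℝ ∞ (chartMul I G) (a, extChartAt I (1 : G) 1) :=
  chartMul_contDiffAt I h (mem_extChartAt_target 1)
    (by rw [extChartAt_one_symm_apply, mul_one]; exact (extChartAt I (1 : G)).map_target h)

/-- The differential of the multiplication at the identity is the addition. -/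
theorem chartMul_hasFDerivAt :
    HasFDerivAt (chartMul I G) (ContinuousLinearMap.fst ℝ E E + ContinuousLinearMap.snd ℝ E E)
      (extChartAt I (1 : G) 1, extChartAt I (1 : G) 1) := by
  have h : HasFDerivAt (chartMul I G) _ (extChartAt I (1 : G) 1, extChartAt I (1 : G) 1) :=
    ((chartMul_contDiffAt_one_right I (mem_extChartAt_target (1 : G))).differentiableAt
      (by simp)).hasFDerivAt
  convert! h using 1
  have hl : (fderiv ℝ (chartMul I G) (extChartAt I (1 : G) 1, extChartAt I (1 : G) 1)).comp
      (.inl ℝ E E) = .id ℝ E :=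
    (HasFDerivAt.comp (f := fun a ↦ (a, extChartAt I (1 : G) 1)) (extChartAt I (1 : G) 1) h
      (hasFDerivAt_prodMk_left _ _)).unique
      ((hasFDerivAt_id _).congr_of_eventuallyEq (by
        filter_upwards [extChartAt_target_mem_nhds_one I (G := G)] with a ha
        exact chartMul_one_right I ha))
  have hr : (fderiv ℝ (chartMul I G) (extChartAt I (1 : G) 1, extChartAt I (1 : G) 1)).comp
      (.inr ℝ E E) = .id ℝ E :=
    (HasFDerivAt.comp (f := fun a ↦ (extChartAt I (1 : G) 1, a)) (extChartAt I (1 : G) 1) h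
      (hasFDerivAt_prodMk_right _ _)).unique
      ((hasFDerivAt_id _).congr_of_eventuallyEq (by
        filter_upwards [extChartAt_target_mem_nhds_one I (G := G)] with a ha
        exact chartMul_one_left I ha))
  ext v
  · simpa using (DFunLike.congr_fun hl v).symm
  · simpa using (DFunLike.congr_fun hr v).symm

/-- The product of two maps into `G` with value `1` at `x` has the sum of the differentials as
differential. -/
theorem hasFDerivAt_extChartAt_mul {f g : F → G} {x : F} {f' g' : F →L[ℝ] E}
    (hf : HasFDerivAt (fun y ↦ extChartAt I (1 : G) (f y)) f' x)
    (hg : HasFDerivAt (fun y ↦ extChartAt I (1 : G) (g y)) g' x) (hf1 : f x = 1) (hg1 : g x = 1)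
    (hfc : ContinuousAt f x) (hgc : ContinuousAt g x) :
    HasFDerivAt (fun y ↦ extChartAt I (1 : G) (f y * g y)) (f' + g') x := by
  have hm := chartMul_hasFDerivAt I (G := G)
  rw [show (extChartAt I (1 : G) 1, extChartAt I (1 : G) 1) =
    (extChartAt I (1 : G) (f x), extChartAt I (1 : G) (g x)) by rw [hf1, hg1]] at hm
  have h := hm.comp x (hf.prodMk hg)
  have e : (ContinuousLinearMap.fst ℝ E E + ContinuousLinearMap.snd ℝ E E).comp (f'.prod g') =
      f' + g' := by ext; simp
  rw [e] at h
  refine h.congr_of_eventuallyEq ?_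
  have hs : (extChartAt I (1 : G)).source ∈ 𝓝 (1 : G) := extChartAt_source_mem_nhds 1
  have h1 : f ⁻¹' (extChartAt I (1 : G)).source ∈ 𝓝 x := hfc.preimage_mem_nhds (by rwa [hf1])
  have h2 : g ⁻¹' (extChartAt I (1 : G)).source ∈ 𝓝 x := hgc.preimage_mem_nhds (by rwa [hg1])
  filter_upwards [h1, h2] with y h1 h2
  simp only [Function.comp_apply, chartMul]
  rw [(extChartAt I (1 : G)).left_inv h1, (extChartAt I (1 : G)).left_inv h2]

/-- The differential of the inversion at the identity is `-1`: differentiate `x * x⁻¹ = 1`. -/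
theorem chartInv_hasFDerivAt :
    HasFDerivAt (chartInv I G) (-ContinuousLinearMap.id ℝ E) (extChartAt I (1 : G) 1) := by
  have hs : ContMDiffAt 𝓘(ℝ, E) I ∞ (extChartAt I (1 : G)).symm (extChartAt I (1 : G) 1) :=
    extChartAt_symm_contMDiffAt I (mem_extChartAt_target 1)
  have hi : ContMDiffAt 𝓘(ℝ, E) I ∞ (fun a ↦ ((extChartAt I (1 : G)).symm a)⁻¹)
      (extChartAt I (1 : G) 1) := hs.inv
  have hd : HasFDerivAt (chartInv I G) (fderiv ℝ (chartInv I G) (extChartAt I (1 : G) 1))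
      (extChartAt I (1 : G) 1) := by
    suffices h : ContDiffAt ℝ ∞ (chartInv I G) (extChartAt I (1 : G) 1) from
      (h.differentiableAt (by simp)).hasFDerivAt
    rw [← contMDiffAt_iff_contDiffAt]
    exact (contMDiffAt_extChartAt' (by simp)).comp (extChartAt I (1 : G) 1) hi
  have h := hasFDerivAt_extChartAt_mul I (f := (extChartAt I (1 : G)).symm)
    (g := fun a ↦ ((extChartAt I (1 : G)).symm a)⁻¹) (x := extChartAt I (1 : G) 1)
    (f' := ContinuousLinearMap.id ℝ E) (g' := fderiv ℝ (chartInv I G) (extChartAt I (1 : G) 1))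
    ((hasFDerivAt_id (𝕜 := ℝ) (extChartAt I (1 : G) 1)).congr_of_eventuallyEq (by
      filter_upwards [extChartAt_target_mem_nhds_one I (G := G)] with a ha
      exact (extChartAt I (1 : G)).right_inv ha)) hd (by simp) (by simp)
    hs.continuousAt hi.continuousAt
  simp only [mul_inv_cancel] at h
  have h0 := h.unique (hasFDerivAt_const _ _)
  rw [← eq_neg_of_add_eq_zero_right h0]
  exact hd

end Chart

section Subgroup

variable {E : Type*} [NormedAddCommGroup E] [NormedSpace ℝ E]
  {K : Type*} [TopologicalSpace K] (I : ModelWithCorners ℝ E K) [I.Boundaryless]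
  {G : Type*} [TopologicalSpace G] [ChartedSpace K G] [Group G] [LieGroup I ∞ G]
  (H : Subgroup G)

/-- A vector which is subtangent to `H` at `1` gives rise, by left translation, to subtangent
vectors at all points of `H` in the domain of the chart. -/
theorem IsSubtangent.translate {y p : E}
    (h : IsSubtangent (chartSubgroup I H) (extChartAt I (1 : G) 1) y)
    (hp : p ∈ chartSubgroup I H) :
    IsSubtangent (chartSubgroup I H) p
      (fderiv ℝ (chartMul I G) (p, extChartAt I (1 : G) 1) (0, y)) := by
  have hd := ((chartMul_contDiffAt_one_right I hp.1).differentiableAt (by simp)).hasFDerivAt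
  have h2 := h.map (S' := chartSubgroup I H) (hd.comp (extChartAt I (1 : G) 1)
    (hasFDerivAt_prodMk_right _ _)) ?_
  · have h3 : IsSubtangent (chartSubgroup I H) (chartMul I G (p, extChartAt I (1 : G) 1))
        (fderiv ℝ (chartMul I G) (p, extChartAt I (1 : G) 1) (0, y)) := h2
    rwa [chartMul_one_right I hp.1] at h3
  have hc : ContinuousAt (fun q ↦ (extChartAt I (1 : G)).symm p * (extChartAt I (1 : G)).symm q)
      (extChartAt I (1 : G) 1) :=
    ((contMDiffAt_const (c := (extChartAt I (1 : G)).symm p)).mul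
      (extChartAt_symm_contMDiffAt I (mem_extChartAt_target 1))).continuousAt
  have hs : (extChartAt I (1 : G)).source ∈
      𝓝 ((extChartAt I (1 : G)).symm p * (extChartAt I (1 : G)).symm (extChartAt I (1 : G) 1)) := by
    rw [extChartAt_one_symm_apply, mul_one]
    exact (isOpen_extChartAt_source 1).mem_nhds ((extChartAt I (1 : G)).map_target hp.1)
  filter_upwards [hc.preimage_mem_nhds hs] with q hq hqH
  refine ⟨(extChartAt I (1 : G)).map_source hq, ?_⟩
  simp only [Function.comp_apply, chartMul]
  rw [(extChartAt I (1 : G)).left_inv hq]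
  exact H.mul_mem hp.2 hqH.2

/-- The inversion maps `H` to itself, and its differential at `1` is `-1`. -/
theorem IsSubtangent.neg {y : E}
    (h : IsSubtangent (chartSubgroup I H) (extChartAt I (1 : G) 1) y) :
    IsSubtangent (chartSubgroup I H) (extChartAt I (1 : G) 1) (-y) := by
  have h2 := h.map (S' := chartSubgroup I H) (chartInv_hasFDerivAt I) ?_
  · simpa [chartInv, extChartAt_one_symm_apply] using h2
  have hc : ContinuousAt (fun q ↦ ((extChartAt I (1 : G)).symm q)⁻¹)
      (extChartAt I (1 : G) 1) :=
    (extChartAt_symm_contMDiffAt I (mem_extChartAt_target (1 : G))).inv.continuousAt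
  have hs : (extChartAt I (1 : G)).source ∈
      𝓝 ((extChartAt I (1 : G)).symm (extChartAt I (1 : G) 1))⁻¹ := by
    rw [extChartAt_one_symm_apply, inv_one]
    exact extChartAt_source_mem_nhds 1
  filter_upwards [hc.preimage_mem_nhds hs] with q hq hqH
  refine ⟨(extChartAt I (1 : G)).map_source hq, ?_⟩
  simp only [chartInv]
  rw [(extChartAt I (1 : G)).left_inv hq]
  exact H.inv_mem hqH.2

/-- A vector which is subtangent to a closed subgroup at `1` is in its Lie algebra: the integral
curve of the left-invariant vector field stays in the subgroup. -/
theorem mem_subgroupLieAlgebra_of_isSubtangent [FiniteDimensional ℝ E]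
    (hclosed : IsClosed (H : Set G)) {y : E}
    (h : IsSubtangent (chartSubgroup I H) (extChartAt I (1 : G) 1) y) :
    y ∈ subgroupLieAlgebra I H := by
  obtain ⟨R, hR, hRt⟩ := Metric.nhds_basis_closedBall.mem_iff.1
    (extChartAt_target_mem_nhds_one I (G := G))
  set e₀ := extChartAt I (1 : G) 1 with he₀
  -- the left-invariant vector field with value `y` at `1`, in the chart
  let v : E → E := fun p ↦ fderiv ℝ (chartMul I G) (p, e₀) (0, y)
  have hball : ∀ p ∈ ball e₀ R, p ∈ (extChartAt I (1 : G)).target := fun p hp ↦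
    hRt (ball_subset_closedBall hp)
  have hv : ContDiffOn ℝ ∞ v (ball e₀ R) := by
    intro p hp
    refine ContDiffAt.contDiffWithinAt ?_
    have h1 : ContDiffAt ℝ ∞ (fderiv ℝ (chartMul I G)) (p, e₀) :=
      (chartMul_contDiffAt_one_right I (hball p hp)).fderiv_right (m := ∞) (by simp)
    have h2 : ContDiffAt ℝ ∞ (fun p : E ↦ (p, e₀)) p := contDiffAt_id.prodMk contDiffAt_const
    exact (h1.comp p h2).clm_apply contDiffAt_const
  -- `chartSubgroup I H` is closed only relative to the domain of the chart
  have hS : IsClosed (chartSubgroup I H ∩ closedBall e₀ R) := by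
    have h1 : ContinuousOn (extChartAt I (1 : G)).symm (closedBall e₀ R) :=
      (continuousOn_extChartAt_symm 1).mono hRt
    convert h1.preimage_isClosed_of_isClosed isClosed_closedBall hclosed using 1
    ext p
    exact ⟨fun hp ↦ ⟨hp.2, hp.1.2⟩, fun hp ↦ ⟨⟨hRt hp.1, hp.2⟩, hp.1⟩⟩
  have hloc : ∀ {p w : E}, p ∈ ball e₀ R → IsSubtangent (chartSubgroup I H) p w →
      IsSubtangent (chartSubgroup I H ∩ closedBall e₀ R) p w := fun hp hw ↦ hw.mono (by
    filter_upwards [isOpen_ball.mem_nhds hp] with q hq hqH using ⟨hqH, ball_subset_closedBall hq⟩)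
  obtain ⟨c, hc, hc0, hcv, hcS⟩ := exists_smooth_curve_of_isSubtangent hS hR (v := v)
    ⟨⟨mem_extChartAt_target 1, by rw [extChartAt_one_symm_apply]; exact H.one_mem⟩,
      mem_closedBall_self hR.le⟩ hv
    (fun p hp ↦ hloc hp.2 (h.translate I H hp.1.1))
    (fun p hp ↦ hloc hp.2 (by
      have h2 := (h.neg I H).translate I H hp.1.1
      have e : ((0 : E), -y) = -((0 : E), y) := by simp
      rwa [e, map_neg] at h2))
  have hv0 : v e₀ = y := by
    simp only [v]
    rw [(chartMul_hasFDerivAt I (G := G)).fderiv]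
    simp
  rw [hv0] at hcv
  have hct : ∀ t, c t ∈ (extChartAt I (1 : G)).target := fun t ↦ hball _ (hcS t).2
  have hsm : ContMDiff 𝓘(ℝ, ℝ) I ∞ fun t ↦ (extChartAt I (1 : G)).symm (c t) := fun t ↦
    (extChartAt_symm_contMDiffAt I (hct t)).comp t hc.contMDiff.contMDiffAt
  have h1 : (extChartAt I (1 : G)).symm (c 0) = 1 := by
    rw [hc0, extChartAt_one_symm_apply]
  refine ⟨fun t ↦ (extChartAt I (1 : G)).symm (c t), hsm, h1, fun t ↦ (hcS t).1.1.2, ?_⟩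
  have hd := hasMFDerivAt_of_extChartAt_comp I (f := fun t ↦ (extChartAt I (1 : G)).symm (c t))
    (x := 0) (f' := ContinuousLinearMap.toSpanSingleton ℝ y) hsm.continuous.continuousAt (by
      rw [h1]
      refine hcv.hasFDerivAt.congr_of_eventuallyEq (Eventually.of_forall fun t ↦ ?_)
      exact (extChartAt I (1 : G)).right_inv (hct t))
  rw [hd.mfderiv]
  exact one_smul ℝ y

end Subgroup

/-! ### Local cross-sections of a closed subgroup -/

/-- The inverse function theorem for a smooth map on an open set, with smoothness of the inverse on
a whole neighbourhood. -/
theorem ContDiffOn.exists_openPartialHomeomorph {E F : Type*} [NormedAddCommGroup E]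
    [NormedSpace ℝ E] [CompleteSpace E] [NormedAddCommGroup F] [NormedSpace ℝ F] {f : E → F}
    {O : Set E} {a : E} (hO : IsOpen O) (ha : a ∈ O) (hf : ContDiffOn ℝ ∞ f O) {f' : E ≃L[ℝ] F}
    (hf' : HasFDerivAt f (f' : E →L[ℝ] F) a) :
    ∃ θ : OpenPartialHomeomorph E F, a ∈ θ.source ∧ θ.source ⊆ O ∧ (∀ z, θ z = f z) ∧
      ContDiffOn ℝ ∞ θ.symm θ.target := by
  have hfa : ContDiffAt ℝ ∞ f a := hf.contDiffAt (hO.mem_nhds ha)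
  have hcont : ContinuousOn (fderiv ℝ f) O := hf.continuousOn_fderiv_of_isOpen hO (by simp)
  set O' := O ∩ fderiv ℝ f ⁻¹' range ((↑) : (E ≃L[ℝ] F) → E →L[ℝ] F) with hO'
  have hO'open : IsOpen O' := hcont.isOpen_inter_preimage hO ContinuousLinearEquiv.isOpen
  have haO' : a ∈ O' := ⟨ha, f', hf'.fderiv.symm⟩
  let θ₀ := hfa.toOpenPartialHomeomorph f hf' (by simp)
  have hθ₀ : ∀ z, θ₀ z = f z := fun z ↦ rfl
  have haθ₀ : a ∈ θ₀.source := hfa.mem_toOpenPartialHomeomorph_source hf' (by simp)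
  refine ⟨θ₀.restrOpen O' hO'open, ⟨haθ₀, haO'⟩, fun z hz ↦ hz.2.1, hθ₀, fun w hw ↦ ?_⟩
  set θ := θ₀.restrOpen O' hO'open
  have hz : θ.symm w ∈ θ.source := θ.map_target hw
  obtain ⟨g, hg⟩ := hz.2.2
  have hsm : ContDiffAt ℝ ∞ f (θ.symm w) := hf.contDiffAt (hO.mem_nhds hz.2.1)
  refine (θ.contDiffAt_symm (f₀' := g) hw ?_ hsm).contDiffWithinAt
  rw [hg]
  exact (hsm.differentiableAt (by simp)).hasFDerivAt

section CrossSection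

theorem HasMFDerivAt.hasFDerivAt_extChartAt_comp {E F K M : Type*} [NormedAddCommGroup E]
    [NormedSpace ℝ E] [NormedAddCommGroup F] [NormedSpace ℝ F] [TopologicalSpace K]
    {I : ModelWithCorners ℝ E K} [TopologicalSpace M] [ChartedSpace K M] {f : F → M} {x : F}
    {f' : F →L[ℝ] E} (hf : HasMFDerivAt 𝓘(ℝ, F) I f x f') :
    HasFDerivAt (fun y ↦ extChartAt I (f x) (f y)) f' x := by
  rw [← hasFDerivWithinAt_univ, ← range_id]
  exact hf.2

variable {E : Type*} [NormedAddCommGroup E] [NormedSpace ℝ E]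
  {K : Type*} [TopologicalSpace K] (I : ModelWithCorners ℝ E K)
  {G : Type*} [TopologicalSpace G] [ChartedSpace K G] [Group G]
  (H : Subgroup G)

/-- A local cross-section of the left cosets of `H`: a slice `toFun` of `G` through `1`, defined on
an open set of `F`, which meets each coset at most once, and a smooth map `proj` from a
neighbourhood of `1` in `G` to `F` which assigns to `x` the parameter of the point of the slice in
the coset of `x`. -/
structure LocalCrossSection (F : Type*) [NormedAddCommGroup F] [NormedSpace ℝ F] where
  /-- the parametrization of the slice -/
  toFun : F → G
  /-- the projection to the parameter space -/
  proj : G → F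
  /-- the domain of the parametrization -/
  dom : Set F
  /-- the domain of the projection -/
  nhd : Set G
  isOpen_dom : IsOpen dom
  isOpen_nhd : IsOpen nhd
  one_mem : 1 ∈ nhd
  smooth_toFun : ContMDiffOn 𝓘(ℝ, F) I ∞ toFun dom
  smooth_proj : ContMDiffOn I 𝓘(ℝ, F) ∞ proj nhd
  proj_mem : ∀ g ∈ nhd, proj g ∈ dom
  toFun_mem : ∀ y ∈ dom, toFun y ∈ nhd
  proj_toFun : ∀ y ∈ dom, proj (toFun y) = y
  inv_mul_mem : ∀ g ∈ nhd, (toFun (proj g))⁻¹ * g ∈ H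
  eq_of_mem : ∀ y ∈ dom, ∀ y' ∈ dom, (toFun y)⁻¹ * toFun y' ∈ H → y = y'

variable [LieGroup I ∞ G] [I.Boundaryless]

/-- A product of curves in `H` gives a smooth map into `H` with prescribed differential into the
Lie algebra of `H`. -/
theorem exists_smooth_map_of_subgroupLieAlgebra {ι : Type*} [Fintype ι] (v : ι → E)
    (hv : ∀ i, v i ∈ (subgroupLieAlgebra I H : Submodule ℝ E)) (s : Finset ι) :
    ∃ Ψ : (ι → ℝ) → G, ContMDiff 𝓘(ℝ, ι → ℝ) I ∞ Ψ ∧ Ψ 0 = 1 ∧ (∀ t, Ψ t ∈ H) ∧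
      HasFDerivAt (fun t ↦ extChartAt I (1 : G) (Ψ t))
        (∑ i ∈ s, (ContinuousLinearMap.proj (R := ℝ) (φ := fun _ : ι ↦ ℝ) i).smulRight (v i))
        0 := by
  classical
  induction s using Finset.induction_on with
  | empty =>
    exact ⟨fun _ ↦ 1, contMDiff_const, rfl, fun _ ↦ H.one_mem, by
      simpa using hasFDerivAt_const _ _⟩
  | insert i s hi ih =>
    obtain ⟨Ψ, hΨ, hΨ0, hΨH, hΨd⟩ := ih
    obtain ⟨c, hc, hc0, hcH, hcv⟩ := hv i
    have hpr : ContMDiff 𝓘(ℝ, ι → ℝ) 𝓘(ℝ, ℝ) ∞ fun t : ι → ℝ ↦ t i :=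
      (contDiff_apply ℝ ℝ i).contMDiff
    have hcd : HasFDerivAt (fun t ↦ extChartAt I (1 : G) (c t))
        (ContinuousLinearMap.toSpanSingleton ℝ (v i)) 0 := by
      obtain ⟨c', hc', hc'1⟩ : ∃ c' : ℝ →L[ℝ] E, HasMFDerivAt 𝓘(ℝ, ℝ) I c 0 c' ∧ c' 1 = v i :=
        ⟨_, ((hc 0).mdifferentiableAt (by simp)).hasMFDerivAt, hcv⟩
      have h := hc'.hasFDerivAt_extChartAt_comp
      rw [hc0] at h
      convert! h using 1
      ext
      simp [hc'1]
    refine ⟨fun t ↦ c (t i) * Ψ t, (hc.comp hpr).mul hΨ, by simp [hc0, hΨ0],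
      fun t ↦ H.mul_mem (hcH _) (hΨH _), ?_⟩
    rw [Finset.sum_insert hi]
    refine hasFDerivAt_extChartAt_mul I (f := fun t : ι → ℝ ↦ c (t i)) ?_ hΨd (by simp [hc0]) hΨ0
      (hc.comp hpr).continuous.continuousAt hΨ.continuous.continuousAt
    have h := HasFDerivAt.comp (f := fun t : ι → ℝ ↦ t i) (0 : ι → ℝ) hcd (hasFDerivAt_apply i 0)
    convert! h using 1

/-- A slice which is transverse to the Lie algebra of `H` meets `H` near `1` only in `1`. If not,
a limit of directions of points of intersection would be subtangent to `H`. -/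
theorem eventually_eq_zero_of_mem [FiniteDimensional ℝ E] {F : Type*} [NormedAddCommGroup F]
    [NormedSpace ℝ F] [FiniteDimensional ℝ F] (hclosed : IsClosed (H : Set G)) {A : F →L[ℝ] E}
    (hA : ∀ y, A y ∈ (subgroupLieAlgebra I H : Submodule ℝ E) → y = 0) :
    ∀ᶠ y in 𝓝 (0 : F),
      (extChartAt I (1 : G)).symm (extChartAt I (1 : G) 1 + A y) ∈ H → y = 0 := by
  by_contra hcon
  obtain ⟨y, hy0, hy'⟩ := Filter.exists_seq_forall_of_frequently (Filter.not_eventually.1 hcon)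
  have hy := fun n ↦ Classical.not_imp.1 (hy' n)
  have hu : ∀ n, ‖y n‖⁻¹ • y n ∈ sphere (0 : F) 1 := fun n ↦ by
    rw [mem_sphere_zero_iff_norm, norm_smul, norm_inv, norm_norm,
      inv_mul_cancel₀ (norm_ne_zero_iff.2 (hy n).2)]
  obtain ⟨u, hu1, ψ, hψ, hlim⟩ := (isCompact_sphere (0 : F) 1).tendsto_subseq hu
  have hyψ : Tendsto (fun n ↦ y (ψ n)) atTop (𝓝 0) := hy0.comp hψ.tendsto_atTop
  have hsub : IsSubtangent (chartSubgroup I H) (extChartAt I (1 : G) 1) (A u) := by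
    refine ⟨fun n ↦ extChartAt I (1 : G) 1 + A (y (ψ n)), fun n ↦ ‖y (ψ n)‖,
      fun n ↦ norm_pos_iff.2 (hy _).2, by simpa using hyψ.norm, ?_, ?_⟩
    · have h1 : Tendsto (fun n ↦ extChartAt I (1 : G) 1 + A (y (ψ n))) atTop
          (𝓝 (extChartAt I (1 : G) 1)) := by
        simpa using ((A.continuous.tendsto 0).comp hyψ).const_add (extChartAt I (1 : G) 1)
      filter_upwards [h1.eventually (extChartAt_target_mem_nhds_one I (G := G))] with n hn
        using ⟨hn, (hy _).1⟩
    · have h2 := (A.continuous.tendsto u).comp hlim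
      refine h2.congr fun n ↦ ?_
      simp
  have := hA u (mem_subgroupLieAlgebra_of_isSubtangent I H hclosed hsub)
  rw [this] at hu1
  simp at hu1

/-- A closed subgroup has a local cross-section. Near `0`, the map `(y, t) ↦ s y * Ψ t`, where `s`
is a slice in a direction complementary to the Lie algebra of `H` and `Ψ` takes values in `H`, is a
local diffeomorphism onto a neighbourhood of `1`. The first coordinate of its inverse is the
projection. -/
theorem exists_localCrossSection [FiniteDimensional ℝ E] (hclosed : IsClosed (H : Set G)) :
    ∃ k : ℕ, Nonempty (LocalCrossSection I H (EuclideanSpace ℝ (Fin k))) := by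
  let 𝔥 : Submodule ℝ E := subgroupLieAlgebra I H
  obtain ⟨𝔪, hc⟩ := Submodule.exists_isCompl 𝔥
  refine ⟨Module.finrank ℝ 𝔪, ?_⟩
  set F := EuclideanSpace ℝ (Fin (Module.finrank ℝ 𝔪))
  let e : F ≃L[ℝ] 𝔪 := ContinuousLinearEquiv.ofFinrankEq (by simp [F])
  let A : F →L[ℝ] E := 𝔪.subtypeL.comp (e : F →L[ℝ] 𝔪)
  let b := Module.finBasis ℝ 𝔥
  set X := Fin (Module.finrank ℝ 𝔥) → ℝ
  obtain ⟨Ψ, hΨ, hΨ0, hΨH, hΨd⟩ := exists_smooth_map_of_subgroupLieAlgebra I H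
    (fun i ↦ (b i : E)) (fun i ↦ (b i).2) Finset.univ
  set D : X →L[ℝ] E := ∑ i, (ContinuousLinearMap.proj (R := ℝ) (φ := fun _ ↦ ℝ) i).smulRight
    (b i : E) with hD
  let T : (F × X) ≃L[ℝ] E := ((e.toLinearEquiv.prodCongr b.equivFun.symm).trans
    (Submodule.prodEquivOfIsCompl 𝔪 𝔥 hc.symm)).toContinuousLinearEquiv
  have hT : (T : F × X →L[ℝ] E) = A.comp (.fst ℝ F X) + D.comp (.snd ℝ F X) := by
    ext z <;> simp [T, A, D, Module.Basis.equivFun_symm_apply, X]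
  have hA : ∀ y, A y ∈ (subgroupLieAlgebra I H : Submodule ℝ E) → y = 0 := by
    intro y hy
    have h : (e y : E) ∈ 𝔥 ⊓ 𝔪 := ⟨hy, (e y).2⟩
    rw [hc.inf_eq_bot, Submodule.mem_bot] at h
    simpa using h
  clear_value T D A
  set φ := extChartAt I (1 : G) with hφ
  let s : F → G := fun y ↦ φ.symm (φ 1 + A y)
  have hs0 : s 0 = 1 := by
    simp only [s, map_zero, add_zero]
    exact extChartAt_one_symm_apply I
  let Φ : F × X → G := fun z ↦ s z.1 * Ψ z.2
  have hΦ0 : Φ 0 = 1 := by simp [Φ, hs0, hΨ0]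
  -- the domain of the slice
  set Q : Set F := (fun y ↦ φ 1 + A y) ⁻¹' φ.target with hQ
  have hQopen : IsOpen Q := (isOpen_extChartAt_target (1 : G)).preimage
    (continuous_const.add A.continuous)
  have hQ0 : (0 : F) ∈ Q := by
    rw [hQ, mem_preimage, map_zero, add_zero]
    exact mem_extChartAt_target 1
  have hssm : ∀ y ∈ Q, ContMDiffAt 𝓘(ℝ, F) I ∞ s y := fun y hy ↦
    (extChartAt_symm_contMDiffAt I hy).comp y
      (contDiff_const.add A.contDiff).contMDiff.contMDiffAt
  have hΦsm : ∀ z : F × X, z.1 ∈ Q → ContMDiffAt 𝓘(ℝ, F × X) I ∞ Φ z := fun z hz ↦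
    ((hssm z.1 hz).comp z contDiff_fst.contMDiff.contMDiffAt).mul
      (hΨ.contMDiffAt.comp z contDiff_snd.contMDiff.contMDiffAt)
  set O : Set (F × X) := Prod.fst ⁻¹' Q ∩ Φ ⁻¹' φ.source with hO
  have hOopen : IsOpen O := ContinuousOn.isOpen_inter_preimage
    (fun z hz ↦ (hΦsm z hz).continuousAt.continuousWithinAt) (hQopen.preimage continuous_fst)
    (isOpen_extChartAt_source 1)
  have hO0 : (0 : F × X) ∈ O := ⟨hQ0, by
    rw [mem_preimage, hΦ0]; exact mem_extChartAt_source 1⟩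
  have hΘ : ContDiffOn ℝ ∞ (fun z ↦ φ (Φ z)) O := by
    intro z hz
    refine ContDiffAt.contDiffWithinAt ?_
    rw [← contMDiffAt_iff_contDiffAt]
    have h2 : Φ z ∈ (chartAt K (1 : G)).source := by simpa [hφ] using hz.2
    exact (contMDiffAt_extChartAt' h2).comp z (hΦsm z hz.1)
  have hΘ' : HasFDerivAt (fun z ↦ φ (Φ z)) (T : F × X →L[ℝ] E) 0 := by
    rw [hT]
    refine hasFDerivAt_extChartAt_mul I (f := fun z : F × X ↦ s z.1)
      (g := fun z : F × X ↦ Ψ z.2) ?_ ?_ hs0 hΨ0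
      (ContinuousAt.comp (f := Prod.fst) (g := s) (hssm 0 hQ0).continuousAt continuousAt_fst)
      (hΨ.continuous.comp continuous_snd).continuousAt
    · have h1 : HasFDerivAt (fun z : F × X ↦ φ 1 + A z.1) (A.comp (.fst ℝ F X)) 0 :=
        (A.comp (.fst ℝ F X)).hasFDerivAt.const_add (φ 1)
      refine h1.congr_of_eventuallyEq ?_
      filter_upwards [(hQopen.preimage continuous_fst).mem_nhds hQ0] with z hz
      exact φ.right_inv hz
    · exact HasFDerivAt.comp (f := Prod.snd) (0 : F × X) hΨd hasFDerivAt_snd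
  obtain ⟨θ, h0θ, hθO, hθ, hθsm⟩ := hΘ.exists_openPartialHomeomorph hOopen hO0 hΘ'
  obtain ⟨ε, hε, hεsub⟩ := Metric.mem_nhds_iff.1 (inter_mem (θ.open_source.mem_nhds h0θ)
    ((continuous_fst.tendsto (0 : F × X)).eventually (eventually_eq_zero_of_mem I H hclosed hA)))
  -- the neighbourhood of `1` which the box of radii `ρ`, `ε` parametrizes
  let N : ℝ → Set G := fun ρ ↦ (φ.source ∩ φ ⁻¹' θ.target) ∩
    (fun g ↦ θ.symm (φ g)) ⁻¹' (ball 0 ρ ×ˢ ball 0 ε)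
  have hNopen₀ : IsOpen (φ.source ∩ φ ⁻¹' θ.target) :=
    (continuousOn_extChartAt 1).isOpen_inter_preimage (isOpen_extChartAt_source 1) θ.open_target
  have hNcont : ContinuousOn (fun g ↦ θ.symm (φ g)) (φ.source ∩ φ ⁻¹' θ.target) :=
    θ.continuousOn_symm.comp ((continuousOn_extChartAt 1).mono inter_subset_left)
      fun g hg ↦ hg.2
  have hNopen : ∀ ρ, IsOpen (N ρ) := fun ρ ↦
    hNcont.isOpen_inter_preimage hNopen₀ (isOpen_ball.prod isOpen_ball)
  have hbox : ∀ {ρ} {z : F × X}, ρ ≤ ε → z ∈ ball (0 : F) ρ ×ˢ ball (0 : X) ε →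
      z ∈ ball (0 : F × X) ε := by
    intro ρ z hρ hz
    rw [← Prod.mk_zero_zero, ← ball_prod_same]
    exact ⟨ball_subset_ball hρ hz.1, hz.2⟩
  have hΦN : ∀ {ρ} {z : F × X}, ρ ≤ ε → z ∈ ball (0 : F) ρ ×ˢ ball (0 : X) ε →
      Φ z ∈ N ρ ∧ θ.symm (φ (Φ z)) = z := by
    intro ρ z hρ hz
    have hzs : z ∈ θ.source := (hεsub (hbox hρ hz)).1
    have hinv : θ.symm (φ (Φ z)) = z := by
      rw [← hθ z]; exact θ.left_inv hzs
    refine ⟨⟨⟨(hθO hzs).2, ?_⟩, ?_⟩, hinv⟩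
    · rw [mem_preimage, ← hθ z]; exact θ.map_source hzs
    · rw [mem_preimage, hinv]; exact hz
  have hNΦ : ∀ {ρ} {g : G}, g ∈ N ρ → Φ (θ.symm (φ g)) = g := by
    intro ρ g hg
    have hzs : θ.symm (φ g) ∈ θ.source := θ.map_target hg.1.2
    refine φ.injOn (hθO hzs).2 hg.1.1 ?_
    rw [← hθ]; exact θ.right_inv hg.1.2
  have hΦs : ∀ y, Φ (y, 0) = s y := fun y ↦ by simp [Φ, hΨ0]
  have h1N : 1 ∈ N ε := by
    rw [← hΦ0]
    exact (hΦN le_rfl ⟨mem_ball_self hε, mem_ball_self hε⟩).1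
  have hball : ∀ {y}, y ∈ ball (0 : F) ε → (y, (0 : X)) ∈ ball (0 : F) ε ×ˢ ball (0 : X) ε :=
    fun hy ↦ ⟨hy, mem_ball_self hε⟩
  -- shrink the slice, so that quotients of its points are in the parametrized neighbourhood
  obtain ⟨δ, hδ, hδsub⟩ : ∃ δ > 0, ∀ y ∈ ball (0 : F) δ, ∀ y' ∈ ball (0 : F) δ,
      (s y)⁻¹ * s y' ∈ N ε := by
    have hcont : ContinuousAt (fun p : F × F ↦ (s p.1)⁻¹ * s p.2) 0 := by
      have h1 : ContMDiffAt 𝓘(ℝ, F × F) I ∞ (fun p : F × F ↦ (s p.1)⁻¹ * s p.2) 0 :=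
        ((hssm 0 hQ0).comp (0 : F × F) contDiff_fst.contMDiff.contMDiffAt).inv.mul
          ((hssm 0 hQ0).comp (0 : F × F) contDiff_snd.contMDiff.contMDiffAt)
      exact h1.continuousAt
    obtain ⟨δ, hδ, h⟩ := Metric.mem_nhds_iff.1 (hcont.preimage_mem_nhds
      ((hNopen ε).mem_nhds (by simpa [hs0] using h1N)))
    refine ⟨δ, hδ, fun y hy y' hy' ↦ h (a := (y, y')) ?_⟩
    rw [← Prod.mk_zero_zero, ← ball_prod_same]
    exact ⟨hy, hy'⟩
  set ρ := min δ ε with hρ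
  have hρε : ρ ≤ ε := min_le_right _ _
  have hρ0 : 0 < ρ := lt_min hδ hε
  have hsN : ∀ y ∈ ball (0 : F) ρ, s y ∈ N ρ ∧ θ.symm (φ (s y)) = (y, 0) := by
    intro y hy
    have h := hΦN (z := (y, 0)) hρε ⟨hy, mem_ball_self hε⟩
    rwa [hΦs y] at h
  have hsm : ContMDiffOn 𝓘(ℝ, F) I ∞ s (ball 0 ρ) := by
    intro y hy
    have hyρ : ((y, 0) : F × X) ∈ ball (0 : F) ρ ×ˢ ball (0 : X) ε := ⟨hy, mem_ball_self hε⟩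
    have hyθ : ((y, 0) : F × X) ∈ θ.source := (hεsub (hbox hρε hyρ)).1
    exact (hssm y (hθO hyθ).1).contMDiffWithinAt
  have hpsm : ContMDiffOn I 𝓘(ℝ, F) ∞ (fun g ↦ (θ.symm (φ g)).1) (N ρ) := by
    intro g hg
    have h1 : ContMDiffAt I 𝓘(ℝ, E) ∞ φ g := by
      have h2 : g ∈ (chartAt K (1 : G)).source := by simpa [hφ] using hg.1.1
      exact contMDiffAt_extChartAt' h2
    have h3 : ContMDiffAt 𝓘(ℝ, E) 𝓘(ℝ, F) ∞ (fun a ↦ (θ.symm a).1) (φ g) :=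
      (contDiff_fst.contDiffAt.comp _
        (hθsm.contDiffAt (θ.open_target.mem_nhds hg.1.2))).contMDiffAt
    exact (h3.comp g h1).contMDiffWithinAt
  have hcoset : ∀ g ∈ N ρ, (s (θ.symm (φ g)).1)⁻¹ * g ∈ H := by
    intro g hg
    have h1 : s (θ.symm (φ g)).1 * Ψ (θ.symm (φ g)).2 = g := hNΦ hg
    rw [inv_mul_eq_iff_eq_mul.2 h1.symm]
    exact hΨH _
  have hinj : ∀ y ∈ ball (0 : F) ρ, ∀ y' ∈ ball (0 : F) ρ, (s y)⁻¹ * s y' ∈ H → y = y' := by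
    intro y hy y' hy' hyy'
    have hn := hδsub y (ball_subset_ball (min_le_left _ _) hy) y'
      (ball_subset_ball (min_le_left _ _) hy')
    set z := θ.symm (φ ((s y)⁻¹ * s y')) with hz
    have hΦz : s z.1 * Ψ z.2 = (s y)⁻¹ * s y' := hNΦ hn
    have hzH : s z.1 ∈ H := by
      rw [eq_mul_inv_of_mul_eq hΦz]
      exact H.mul_mem hyy' (H.inv_mem (hΨH _))
    -- the slice meets `H` only in `1`, so that the quotient is a small element of `H`
    have hz1 : z.1 = 0 := (hεsub (hbox le_rfl hn.2)).2 hzH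
    have hyz : Φ (y, z.2) = Φ (y', 0) := by
      rw [hΦs y']
      rw [hz1, hs0, one_mul] at hΦz
      simp only [Φ, hΦz, mul_inv_cancel_left]
    have e1 := (hΦN (ρ := ε) (z := (y, z.2)) le_rfl ⟨ball_subset_ball hρε hy, hn.2.2⟩).2
    have e2 := (hΦN (ρ := ε) (z := (y', 0)) le_rfl (hball (ball_subset_ball hρε hy'))).2
    rw [hyz, e2] at e1
    exact (Prod.ext_iff.1 e1).1.symm
  have h1ρ : 1 ∈ N ρ := by
    rw [← hΦ0]
    exact (hΦN hρε ⟨mem_ball_self hρ0, mem_ball_self hε⟩).1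
  exact ⟨⟨s, fun g ↦ (θ.symm (φ g)).1, ball 0 ρ, N ρ, isOpen_ball, hNopen ρ, h1ρ, hsm, hpsm,
    fun g hg ↦ hg.2.1, fun y hy ↦ (hsN y hy).1, fun y hy ↦ congrArg Prod.fst (hsN y hy).2,
    hcoset, hinj⟩⟩

end CrossSection

/-! ### The manifold structure of the coset space -/

namespace LocalCrossSection

variable {E : Type*} [NormedAddCommGroup E] [NormedSpace ℝ E]
  {K : Type*} [TopologicalSpace K] {I : ModelWithCorners ℝ E K}
  {G : Type*} [TopologicalSpace G] [ChartedSpace K G] [Group G]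
  {H : Subgroup G} {F : Type*} [NormedAddCommGroup F] [NormedSpace ℝ F]
  (σ : LocalCrossSection I H F)

theorem mk_toFun_proj {g : G} (hg : g ∈ σ.nhd) : (σ.toFun (σ.proj g) : G ⧸ H) = g :=
  QuotientGroup.eq.2 (σ.inv_mul_mem g hg)

variable [IsTopologicalGroup G]

/-- The parametrization of a neighbourhood of the base point of `G ⧸ H` by a local
cross-section. -/
def param : OpenPartialHomeomorph F (G ⧸ H) :=
  haveI : Nonempty F := ⟨0⟩
  have hinj : InjOn (fun y ↦ (σ.toFun y : G ⧸ H)) σ.dom := fun y hy y' hy' h ↦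
    σ.eq_of_mem y hy y' hy' (QuotientGroup.eq.1 h)
  OpenPartialHomeomorph.ofContinuousOpenRestrict (hinj.toPartialEquiv _ _)
    (QuotientGroup.continuous_mk.comp_continuousOn σ.smooth_toFun.continuousOn)
    (by
      intro V hV
      obtain ⟨V', hV', rfl⟩ := isOpen_induced_iff.1 hV
      have hopen : IsOpen (σ.nhd ∩ σ.proj ⁻¹' V') :=
        σ.smooth_proj.continuousOn.isOpen_inter_preimage σ.isOpen_nhd hV'
      convert QuotientGroup.isOpenMap_coe _ hopen using 1
      ext p
      constructor
      · rintro ⟨y, hy, rfl⟩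
        exact ⟨σ.toFun y, ⟨σ.toFun_mem y y.2, by rwa [mem_preimage, σ.proj_toFun y y.2]⟩, rfl⟩
      · rintro ⟨g, hg, rfl⟩
        exact ⟨⟨σ.proj g, σ.proj_mem g hg.1⟩, hg.2, σ.mk_toFun_proj hg.1⟩)
    σ.isOpen_dom

theorem param_apply (y : F) : σ.param y = (σ.toFun y : G ⧸ H) := rfl

theorem param_source : σ.param.source = σ.dom := rfl

theorem mk_mem_param_target {g : G} (hg : g ∈ σ.nhd) : (g : G ⧸ H) ∈ σ.param.target := by
  rw [← σ.mk_toFun_proj hg, ← param_apply]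
  exact σ.param.map_source (σ.proj_mem g hg)

theorem param_symm_mk {g : G} (hg : g ∈ σ.nhd) : σ.param.symm (g : G ⧸ H) = σ.proj g := by
  rw [← σ.mk_toFun_proj hg, ← param_apply]
  exact σ.param.left_inv (σ.proj_mem g hg)

/-- The chart of `G ⧸ H` near the coset of `a`: the translate by `a` of the chart which is given
by the local cross-section. -/
def chart (a : G) : OpenPartialHomeomorph (G ⧸ H) F :=
  (Homeomorph.smul a⁻¹).toOpenPartialHomeomorph.trans σ.param.symm

theorem chart_apply (a : G) (p : G ⧸ H) : σ.chart a p = σ.param.symm (a⁻¹ • p) := rfl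

theorem mem_chart_source {a : G} {p : G ⧸ H} :
    p ∈ (σ.chart a).source ↔ a⁻¹ • p ∈ σ.param.target := by
  simp [chart]

theorem chart_target (a : G) : (σ.chart a).target = σ.dom := by
  simp [chart, param_source]

theorem chart_symm_apply (a : G) (y : F) :
    (σ.chart a).symm y = ((a * σ.toFun y : G) : G ⧸ H) := by
  simp [chart, param_apply]

/-- A point of the domain of a chart can be moved into the slice by the action of `H`. -/
theorem exists_mul_eq_toFun {a x : G} (hx : (x : G ⧸ H) ∈ (σ.chart a).source) :
    ∃ h ∈ H, a * σ.toFun (σ.chart a x) = x * h := by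
  have h1 : ((a * σ.toFun (σ.chart a x) : G) : G ⧸ H) = x := by
    rw [← chart_symm_apply]
    exact (σ.chart a).left_inv hx
  exact ⟨x⁻¹ * (a * σ.toFun (σ.chart a x)), QuotientGroup.eq.1 h1.symm, by group⟩

variable [LieGroup I ∞ G]

/-- The projection of `G` is smooth in the charts of `G ⧸ H`. -/
theorem contMDiffAt_chart_mk {a x : G} (hx : (x : G ⧸ H) ∈ (σ.chart a).source) :
    ContMDiffAt I 𝓘(ℝ, F) ∞ (fun x : G ↦ σ.chart a (x : G ⧸ H)) x := by
  obtain ⟨h, hh, hxh⟩ := σ.exists_mul_eq_toFun hx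
  have hdom : σ.chart a (x : G ⧸ H) ∈ σ.dom := by
    rw [← σ.chart_target a]; exact (σ.chart a).map_source hx
  have htr : ContMDiff I I ∞ fun z : G ↦ a⁻¹ * (z * h) :=
    contMDiff_const.mul (contMDiff_id.mul contMDiff_const)
  have hx' : a⁻¹ * (x * h) ∈ σ.nhd := by
    rw [← hxh, inv_mul_cancel_left]
    exact σ.toFun_mem _ hdom
  have hev : ∀ᶠ z in 𝓝 x, a⁻¹ * (z * h) ∈ σ.nhd :=
    htr.continuous.continuousAt.preimage_mem_nhds (σ.isOpen_nhd.mem_nhds hx')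
  have hsm : ContMDiffAt I 𝓘(ℝ, F) ∞ (fun z : G ↦ σ.proj (a⁻¹ * (z * h))) x :=
    (σ.smooth_proj.contMDiffAt (σ.isOpen_nhd.mem_nhds hx')).comp x htr.contMDiffAt
  refine hsm.congr_of_eventuallyEq ?_
  filter_upwards [hev] with z hz
  have hz' : ((z * h : G) : G ⧸ H) = z := QuotientGroup.mk_mul_of_mem z hh
  rw [← σ.param_symm_mk hz, chart_apply, ← hz']
  rfl

/-- The atlas of `G ⧸ H` of the translates of the chart of a local cross-section. -/
@[reducible]
def chartedSpace : ChartedSpace F (G ⧸ H) where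
  atlas := range σ.chart
  chartAt p := σ.chart p.out
  mem_chart_source p := by
    rw [σ.mem_chart_source]
    have h : (p.out)⁻¹ • p = ((1 : G) : G ⧸ H) := by
      conv_lhs => rw [← QuotientGroup.out_eq' p]
      rw [MulAction.Quotient.smul_coe]
      simp
    rw [h]
    exact σ.mk_mem_param_target σ.one_mem
  chart_mem_atlas p := mem_range_self _

theorem isManifold : letI := σ.chartedSpace; IsManifold 𝓘(ℝ, F) ∞ (G ⧸ H) := by
  let := σ.chartedSpace
  refine isManifold_of_contDiffOn 𝓘(ℝ, F) ∞ (G ⧸ H) ?_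
  rintro _ _ ⟨a, rfl⟩ ⟨b, rfl⟩
  intro y hy
  have hy' : y ∈ ((σ.chart a).symm.trans (σ.chart b)).source := hy.1
  rw [OpenPartialHomeomorph.trans_source] at hy'
  have hydom : y ∈ σ.dom := by rw [← σ.chart_target a]; exact hy'.1
  have hys : ((a * σ.toFun y : G) : G ⧸ H) ∈ (σ.chart b).source := by
    rw [← chart_symm_apply]; exact hy'.2
  have h1 : ContMDiffAt 𝓘(ℝ, F) I ∞ (fun y ↦ a * σ.toFun y) y :=
    contMDiffAt_const.mul (σ.smooth_toFun.contMDiffAt (σ.isOpen_dom.mem_nhds hydom))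
  have h2 := ((σ.contMDiffAt_chart_mk hys).comp y h1).contDiffAt
  refine (h2.congr_of_eventuallyEq (Eventually.of_forall fun z ↦ ?_)).contDiffWithinAt
  have h3 := σ.chart_symm_apply a z
  exact congrArg (σ.chart b) h3

theorem isSmoothSubmersion :
    letI := σ.chartedSpace; IsSmoothSubmersion I 𝓘(ℝ, F) (fun x : G ↦ (x : G ⧸ H)) := by
  let := σ.chartedSpace
  have := σ.isManifold
  have hsm : ContMDiff I 𝓘(ℝ, F) ∞ (fun x : G ↦ (x : G ⧸ H)) := fun x ↦
    contMDiffAt_iff_target.2 ⟨QuotientGroup.continuous_mk.continuousAt,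
      σ.contMDiffAt_chart_mk (ChartedSpace.mem_chart_source (H := F) (x : G ⧸ H))⟩
  refine ⟨hsm, fun x w ↦ ?_⟩
  -- a translate of the slice is a section of the projection through `x`
  set a : G := (x : G ⧸ H).out
  have hx : (x : G ⧸ H) ∈ (σ.chart a).source :=
    ChartedSpace.mem_chart_source (H := F) (x : G ⧸ H)
  obtain ⟨h, hh, hxh⟩ := σ.exists_mul_eq_toFun hx
  set y₀ := σ.chart a (x : G ⧸ H) with hy₀
  have hdom : y₀ ∈ σ.dom := by
    rw [← σ.chart_target a]; exact (σ.chart a).map_source hx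
  let c : F → G := fun y ↦ a * σ.toFun y * h⁻¹
  have hc : ContMDiffAt 𝓘(ℝ, F) I ∞ c y₀ :=
    (contMDiffAt_const.mul (σ.smooth_toFun.contMDiffAt (σ.isOpen_dom.mem_nhds hdom))).mul
      contMDiffAt_const
  have hc0 : c y₀ = x := by simp [c, hxh]
  have hcomp : (fun y ↦ extChartAt 𝓘(ℝ, F) (x : G ⧸ H) (c y : G ⧸ H)) =ᶠ[𝓝 y₀] id := by
    filter_upwards [σ.isOpen_dom.mem_nhds hdom] with y hy
    have h1 : (c y : G ⧸ H) = (σ.chart a).symm y := by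
      rw [chart_symm_apply]
      exact QuotientGroup.mk_mul_of_mem _ (H.inv_mem hh)
    rw [h1]
    exact (σ.chart a).right_inv (by rwa [σ.chart_target a])
  have hd1 : MDifferentiableAt I 𝓘(ℝ, F) (fun x : G ↦ (x : G ⧸ H)) (c y₀) :=
    (hsm _).mdifferentiableAt (by simp)
  have hd2 : MDifferentiableAt 𝓘(ℝ, F) I c y₀ := hc.mdifferentiableAt (by simp)
  have hD := HasMFDerivAt.hasFDerivAt_extChartAt_comp (E := F) (F := F)
    (f' := (mfderiv I 𝓘(ℝ, F) (fun x : G ↦ (x : G ⧸ H)) (c y₀)).comp (mfderiv 𝓘(ℝ, F) I c y₀))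
    (HasMFDerivAt.comp y₀ hd1.hasMFDerivAt hd2.hasMFDerivAt)
  have hid := hD.unique ((hasFDerivAt_id y₀).congr_of_eventuallyEq (by
    simpa only [Function.comp_apply, hc0] using hcomp))
  have key : ∀ z, c y₀ = z →
      ∃ v : E, (mfderiv I 𝓘(ℝ, F) (fun x : G ↦ (x : G ⧸ H)) z v : F) = w := by
    rintro _ rfl
    exact ⟨mfderiv 𝓘(ℝ, F) I c y₀ w, DFunLike.congr_fun hid w⟩
  exact key x hc0

end LocalCrossSection

/-- The coset space of a closed subgroup is a smooth manifold, and the projection is a smooth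
submersion. -/
theorem exists_isSmoothSubmersion_mk {E : Type*} [NormedAddCommGroup E] [NormedSpace ℝ E]
    [FiniteDimensional ℝ E] {K : Type*} [TopologicalSpace K] (I : ModelWithCorners ℝ E K)
    [I.Boundaryless] {G : Type*} [TopologicalSpace G] [ChartedSpace K G] [Group G]
    [LieGroup I ∞ G] (H : Subgroup G) (hclosed : IsClosed (H : Set G)) :
    ∃ (k : ℕ) (_ : ChartedSpace (EuclideanSpace ℝ (Fin k)) (G ⧸ H))
      (_ : IsManifold (𝓡 k) ∞ (G ⧸ H)),
      IsSmoothSubmersion I (𝓡 k) (fun x : G ↦ (x : G ⧸ H)) := by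
  have := topologicalGroup_of_lieGroup I ∞ (G := G)
  obtain ⟨k, ⟨σ⟩⟩ := exists_localCrossSection I H hclosed
  exact ⟨k, σ.chartedSpace, σ.isManifold, σ.isSmoothSubmersion⟩

/-! ### Submersions onto the coset space -/

section LocalSections

variable {E : Type*} [NormedAddCommGroup E] [NormedSpace ℝ E]
  {K : Type*} [TopologicalSpace K] {I : ModelWithCorners ℝ E K} [I.Boundaryless]
  {M : Type*} [TopologicalSpace M] [ChartedSpace K M] [IsManifold I ∞ M]
  {F : Type*} [NormedAddCommGroup F] [NormedSpace ℝ F] [FiniteDimensional ℝ F]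
  {N : Type*} [TopologicalSpace N] [ChartedSpace F N] [IsManifold 𝓘(ℝ, F) ∞ N]

/-- A smooth submersion has smooth local sections: restrict it to a slice on which its differential
is invertible, and use the inverse function theorem. -/
theorem IsSmoothSubmersion.exists_local_section {f : M → N}
    (hf : IsSmoothSubmersion I 𝓘(ℝ, F) f) (x : M) :
    ∃ (τ : N → M) (V : Set N), IsOpen V ∧ f x ∈ V ∧ ContMDiffOn 𝓘(ℝ, F) I ∞ τ V ∧ τ (f x) = x ∧
      ∀ y ∈ V, f (τ y) = y := by
  obtain ⟨D, hD, hDs⟩ : ∃ D : E →L[ℝ] F, HasMFDerivAt I 𝓘(ℝ, F) f x D ∧ Function.Surjective D :=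
    ⟨_, ((hf.smooth x).mdifferentiableAt (by simp)).hasMFDerivAt, hf.surjective x⟩
  obtain ⟨R₀, hR₀⟩ := D.toLinearMap.exists_rightInverse_of_surjective
    (LinearMap.range_eq_top.2 hDs)
  let R : F →L[ℝ] E := R₀.toContinuousLinearMap
  have hDR : D.comp R = ContinuousLinearMap.id ℝ F := by
    ext u
    exact DFunLike.congr_fun hR₀ u
  set φ := extChartAt I x with hφ
  set χ := extChartAt 𝓘(ℝ, F) (f x) with hχ
  let c : F → M := fun u ↦ φ.symm (φ x + R u)
  have hc0 : c 0 = x := by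
    simp only [c, map_zero, add_zero]
    exact φ.left_inv (mem_extChartAt_source x)
  set Q : Set F := (fun u ↦ φ x + R u) ⁻¹' φ.target with hQ
  have hQopen : IsOpen Q :=
    (isOpen_extChartAt_target x).preimage (continuous_const.add R.continuous)
  have hQ0 : (0 : F) ∈ Q := by
    rw [hQ, mem_preimage, map_zero, add_zero]
    exact mem_extChartAt_target x
  have hcsm : ∀ u ∈ Q, ContMDiffAt 𝓘(ℝ, F) I ∞ c u := fun u hu ↦
    (extChartAt_symm_contMDiffAt I hu).comp u
      (contDiff_const.add R.contDiff).contMDiff.contMDiffAt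
  have hfcsm : ∀ u ∈ Q, ContMDiffAt 𝓘(ℝ, F) 𝓘(ℝ, F) ∞ (fun u ↦ f (c u)) u := fun u hu ↦
    (hf.smooth _).comp u (hcsm u hu)
  set O : Set F := Q ∩ (fun u ↦ f (c u)) ⁻¹' χ.source with hO
  have hOopen : IsOpen O := ContinuousOn.isOpen_inter_preimage
    (fun u hu ↦ (hfcsm u hu).continuousAt.continuousWithinAt) hQopen (isOpen_extChartAt_source _)
  have hO0 : (0 : F) ∈ O := ⟨hQ0, by
    rw [mem_preimage, hc0]; exact mem_extChartAt_source _⟩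
  have hqsm : ContDiffOn ℝ ∞ (fun u ↦ χ (f (c u))) O := by
    intro u hu
    refine ContDiffAt.contDiffWithinAt ?_
    rw [← contMDiffAt_iff_contDiffAt]
    have h2 : f (c u) ∈ (chartAt F (f x)).source := by simpa [hχ] using hu.2
    exact (contMDiffAt_extChartAt' h2).comp u (hfcsm u hu.1)
  have hcd : HasMFDerivAt 𝓘(ℝ, F) I c 0 R := by
    refine hasMFDerivAt_of_extChartAt_comp I (hcsm 0 hQ0).continuousAt ?_
    rw [hc0]
    refine (R.hasFDerivAt.const_add (φ x)).congr_of_eventuallyEq ?_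
    filter_upwards [hQopen.mem_nhds hQ0] with u hu
    exact φ.right_inv hu
  have hqd : HasFDerivAt (fun u ↦ χ (f (c u))) (ContinuousLinearEquiv.refl ℝ F : F →L[ℝ] F) 0 := by
    rw [← hc0] at hD
    have h := HasMFDerivAt.hasFDerivAt_extChartAt_comp (f' := D.comp R) (HasMFDerivAt.comp 0 hD hcd)
    rw [hDR] at h
    simp only [Function.comp_apply, hc0] at h
    exact h
  obtain ⟨θ, h0θ, hθO, hθ, hθsm⟩ := hqsm.exists_openPartialHomeomorph hOopen hO0 hqd
  have hθ0 : θ 0 = χ (f x) := by rw [hθ, hc0]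
  refine ⟨fun y ↦ c (θ.symm (χ y)), χ.source ∩ χ ⁻¹' θ.target,
    (continuousOn_extChartAt _).isOpen_inter_preimage (isOpen_extChartAt_source _) θ.open_target,
    ⟨mem_extChartAt_source _, ?_⟩, ?_, ?_, ?_⟩
  · rw [mem_preimage, ← hθ0]
    exact θ.map_source h0θ
  · intro y hy
    have h1 : ContMDiffAt 𝓘(ℝ, F) 𝓘(ℝ, F) ∞ χ y := by
      have h2 : y ∈ (chartAt F (f x)).source := by simpa [hχ] using hy.1
      exact contMDiffAt_extChartAt' h2
    have h3 : ContMDiffAt 𝓘(ℝ, F) 𝓘(ℝ, F) ∞ θ.symm (χ y) :=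
      (hθsm.contDiffAt (θ.open_target.mem_nhds hy.2)).contMDiffAt
    exact ((hcsm _ (hθO (θ.map_target hy.2)).1).comp y (h3.comp y h1)).contMDiffWithinAt
  · simp only [← hθ0, θ.left_inv h0θ, hc0]
  · intro y hy
    have hu : θ.symm (χ y) ∈ O := hθO (θ.map_target hy.2)
    refine χ.injOn hu.2 hy.1 ?_
    have h1 := θ.right_inv hy.2
    rwa [hθ] at h1

end LocalSections

section Coset

variable {E : Type*} [NormedAddCommGroup E] [NormedSpace ℝ E]
  {K : Type*} [TopologicalSpace K] {I : ModelWithCorners ℝ E K} [I.Boundaryless]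
  {G : Type*} [TopologicalSpace G] [ChartedSpace K G] [Group G] [LieGroup I ∞ G]
  {H : Subgroup G}
  {F : Type*} [NormedAddCommGroup F] [NormedSpace ℝ F] [FiniteDimensional ℝ F]
  [ChartedSpace F (G ⧸ H)] [IsManifold 𝓘(ℝ, F) ∞ (G ⧸ H)]

/-- The action of `G` on the coset space is smooth. -/
theorem contMDiff_smul_of_isSmoothSubmersion
    (hπ : IsSmoothSubmersion I 𝓘(ℝ, F) (fun x : G ↦ (x : G ⧸ H))) (a : G) :
    ContMDiff 𝓘(ℝ, F) 𝓘(ℝ, F) ∞ (fun p : G ⧸ H ↦ a • p) := by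
  intro p
  obtain ⟨x, rfl⟩ := QuotientGroup.mk_surjective p
  obtain ⟨τ, V, hV, hxV, hτ, -, hτV⟩ := hπ.exists_local_section x
  have h1 : ContMDiffAt 𝓘(ℝ, F) I ∞ (fun p ↦ a * τ p) (x : G ⧸ H) :=
    contMDiffAt_const.mul (hτ.contMDiffAt (hV.mem_nhds hxV))
  refine ((hπ.smooth _).comp _ h1).congr_of_eventuallyEq ?_
  filter_upwards [hV.mem_nhds hxV] with q hq
  conv_lhs => rw [← hτV q hq]
  rfl

theorem IsSubtangent.of_hasDerivAt {S : Set E} {q : ℝ → E} {w : E} (hq : HasDerivAt q w 0)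
    (hS : ∀ᶠ t in 𝓝 0, q t ∈ S) : IsSubtangent S (q 0) w := by
  have hlim : Tendsto (fun n : ℕ ↦ 1 / ((n : ℝ) + 1)) atTop (𝓝 0) :=
    tendsto_one_div_add_atTop_nhds_zero_nat
  refine ⟨fun n ↦ q (1 / ((n : ℝ) + 1)), fun n ↦ 1 / ((n : ℝ) + 1), fun n ↦ by positivity, hlim,
    hlim.eventually hS, ?_⟩
  have h := (hasDerivAt_iff_tendsto_slope_zero.1 hq).comp
    (tendsto_nhdsWithin_iff.2 ⟨hlim, Eventually.of_forall fun n ↦ by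
      have : (0 : ℝ) < 1 / ((n : ℝ) + 1) := by positivity
      exact this.ne'⟩)
  simpa [Function.comp_def] using h

/-- The kernel of the differential of the projection at `1` is the Lie algebra of `H`. A curve with
velocity in the kernel is moved into `H` by a local section of the projection. -/
theorem mfderiv_mk_eq_zero_iff [FiniteDimensional ℝ E] (hclosed : IsClosed (H : Set G))
    (hπ : IsSmoothSubmersion I 𝓘(ℝ, F) (fun x : G ↦ (x : G ⧸ H))) (v : GroupLieAlgebra I G) :
    mfderiv I 𝓘(ℝ, F) (fun x : G ↦ (x : G ⧸ H)) 1 v = 0 ↔ v ∈ subgroupLieAlgebra I H := by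
  obtain ⟨D, hD, hDv⟩ : ∃ D : E →L[ℝ] F, HasMFDerivAt I 𝓘(ℝ, F) (fun x : G ↦ (x : G ⧸ H)) 1 D ∧
      ∀ v : E, mfderiv I 𝓘(ℝ, F) (fun x : G ↦ (x : G ⧸ H)) 1 v = D v :=
    ⟨_, ((hπ.smooth 1).mdifferentiableAt (by simp)).hasMFDerivAt, fun _ ↦ rfl⟩
  suffices hE : ∀ v : E, D v = 0 ↔ v ∈ (subgroupLieAlgebra I H : Submodule ℝ E) from
    Iff.trans (b := D v = 0) (by rw [← hDv v]; rfl) (hE v)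
  clear v
  refine fun v ↦ ⟨fun hv ↦ ?_, ?_⟩
  · obtain ⟨τ, V, hV, hxV, hτ, hτ1, hτV⟩ := hπ.exists_local_section 1
    set φ := extChartAt I (1 : G) with hφ
    have hφt : φ.target ∈ 𝓝 (φ 1) := extChartAt_target_mem_nhds 1
    let c₀ : ℝ → G := fun t ↦ φ.symm (φ 1 + t • v)
    have hc₀0 : c₀ 0 = 1 := by
      simp only [c₀, zero_smul, add_zero]
      exact φ.left_inv (mem_extChartAt_source 1)
    have hline : ContDiff ℝ ∞ fun t : ℝ ↦ φ 1 + t • v :=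
      contDiff_const.add (contDiff_id.smul contDiff_const)
    have hc₀ : ContMDiffAt 𝓘(ℝ, ℝ) I ∞ c₀ 0 := by
      refine ContMDiffAt.comp (0 : ℝ) (extChartAt_symm_contMDiffAt I ?_)
        hline.contMDiff.contMDiffAt
      rw [zero_smul, add_zero]
      exact mem_extChartAt_target 1
    have hc₀d : HasFDerivAt (fun t ↦ φ (c₀ t)) (ContinuousLinearMap.toSpanSingleton ℝ v) 0 := by
      have h1 : HasFDerivAt (fun t : ℝ ↦ φ 1 + t • v)
          (ContinuousLinearMap.toSpanSingleton ℝ v) 0 :=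
        (ContinuousLinearMap.toSpanSingleton ℝ v).hasFDerivAt.const_add (φ 1)
      refine h1.congr_of_eventuallyEq ?_
      have h2 : ∀ᶠ t : ℝ in 𝓝 0, φ 1 + t • v ∈ φ.target :=
        hline.continuous.continuousAt.preimage_mem_nhds (by simpa using hφt)
      filter_upwards [h2] with t ht
      exact φ.right_inv ht
    let b : ℝ → G := fun t ↦ τ ((c₀ t : G) : G ⧸ H)
    have hb0 : b 0 = 1 := by simp only [b, hc₀0]; exact hτ1
    have hτat : ContMDiffAt 𝓘(ℝ, F) I ∞ τ ((c₀ 0 : G) : G ⧸ H) := by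
      rw [hc₀0]; exact hτ.contMDiffAt (hV.mem_nhds hxV)
    have hπc : ContMDiffAt 𝓘(ℝ, ℝ) 𝓘(ℝ, F) ∞ (fun t ↦ ((c₀ t : G) : G ⧸ H)) 0 :=
      (hπ.smooth _).comp (0 : ℝ) hc₀
    have hb : ContMDiffAt 𝓘(ℝ, ℝ) I ∞ b 0 := ContMDiffAt.comp (0 : ℝ) hτat hπc
    -- `b` has velocity `0`, so that `b⁻¹ * c₀`, which runs in `H`, has the same velocity as `c₀`
    have hbd : HasFDerivAt (fun t ↦ φ (b t)) (0 : ℝ →L[ℝ] E) 0 := by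
      have h1 : HasMFDerivAt 𝓘(ℝ, ℝ) I c₀ 0 (ContinuousLinearMap.toSpanSingleton ℝ v) := by
        refine hasMFDerivAt_of_extChartAt_comp I hc₀.continuousAt ?_
        rw [hc₀0]; exact hc₀d
      have hD' := hD
      rw [← hc₀0] at hD'
      have h2 := HasMFDerivAt.comp (0 : ℝ) hD' h1
      obtain ⟨T, hT⟩ : ∃ T : F →L[ℝ] E, HasMFDerivAt 𝓘(ℝ, F) I τ ((c₀ 0 : G) : G ⧸ H) T :=
        ⟨_, (hτat.mdifferentiableAt (by simp)).hasMFDerivAt⟩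
      have h3 := HasMFDerivAt.hasFDerivAt_extChartAt_comp (f := b)
        (f' := T.comp (D.comp (ContinuousLinearMap.toSpanSingleton ℝ v)))
        (HasMFDerivAt.comp (0 : ℝ) hT h2)
      rw [hb0] at h3
      have h4 : T.comp (D.comp (ContinuousLinearMap.toSpanSingleton ℝ v)) = 0 := by
        ext
        have : D v = 0 := hv
        simp [this]
      rwa [h4] at h3
    let c : ℝ → G := fun t ↦ (b t)⁻¹ * c₀ t
    have hc0 : c 0 = 1 := by simp [c, hb0, hc₀0]
    have hc : ContMDiffAt 𝓘(ℝ, ℝ) I ∞ c 0 := hb.inv.mul hc₀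
    obtain ⟨c', hc'⟩ : ∃ c' : ℝ →L[ℝ] E, HasMFDerivAt 𝓘(ℝ, ℝ) I c 0 c' :=
      ⟨_, (hc.mdifferentiableAt (by simp)).hasMFDerivAt⟩
    have hcd := hc'.hasFDerivAt_extChartAt_comp
    rw [hc0] at hcd
    have hmul := hasFDerivAt_extChartAt_mul I hbd hcd hb0 hc0 hb.continuousAt hc.continuousAt
    simp only [c, mul_inv_cancel_left, zero_add] at hmul
    rw [hmul.unique hc₀d] at hcd
    have hsub := IsSubtangent.of_hasDerivAt (S := chartSubgroup I H) hcd.hasDerivAt ?_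
    · simp only [hc0, ContinuousLinearMap.toSpanSingleton_apply, one_smul] at hsub
      exact mem_subgroupLieAlgebra_of_isSubtangent I H hclosed hsub
    have h1 : ∀ᶠ t in 𝓝 (0 : ℝ), c t ∈ φ.source := hc.continuousAt.preimage_mem_nhds (by
      rw [hc0]; exact extChartAt_source_mem_nhds 1)
    have h2 : ∀ᶠ t in 𝓝 (0 : ℝ), ((c₀ t : G) : G ⧸ H) ∈ V :=
      hπc.continuousAt.preimage_mem_nhds (by rw [hc₀0]; exact hV.mem_nhds hxV)
    filter_upwards [h1, h2] with t ht1 ht2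
    refine ⟨φ.map_source ht1, ?_⟩
    rw [φ.left_inv ht1]
    exact QuotientGroup.eq.1 (hτV _ ht2)
  · rintro ⟨c, hc, hc0, hcH, hcv⟩
    obtain ⟨c', hc', hc'1⟩ : ∃ c' : ℝ →L[ℝ] E, HasMFDerivAt 𝓘(ℝ, ℝ) I c 0 c' ∧ c' 1 = v :=
      ⟨_, ((hc 0).mdifferentiableAt (by simp)).hasMFDerivAt, hcv⟩
    rw [← hc0] at hD
    have h := HasMFDerivAt.hasFDerivAt_extChartAt_comp (f' := D.comp c')
      (HasMFDerivAt.comp (0 : ℝ) hD hc')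
    have hconst : ∀ t, ((c t : G) : G ⧸ H) = ((1 : G) : G ⧸ H) := fun t ↦
      (QuotientGroup.eq.2 (by simpa using hcH t)).symm
    simp only [Function.comp_apply, hconst] at h
    have h0 := h.unique (hasFDerivAt_const _ _)
    have := DFunLike.congr_fun h0 (1 : ℝ)
    simpa [hc'1] using this

end Coset

/-! ### The horizontal part of a bilinear form -/

section LinearAlgebra

variable {V : Type*} [AddCommGroup V] [Module ℝ V] [TopologicalSpace V]

theorem isCompl_formOrthogonal [FiniteDimensional ℝ V] {B : V →L[ℝ] V →L[ℝ] ℝ} (hB : FormSymm B)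
    {S : Submodule ℝ V} (hS : FormNondegenerateOn B S) : IsCompl S (formOrthogonal B S) := by
  let b : LinearMap.BilinForm ℝ V := LinearMap.mk₂ ℝ (fun v w ↦ B v w) (by simp) (by simp)
    (by simp) (by simp)
  have hrefl : b.IsRefl := fun v w h ↦ by
    change B w v = 0
    rw [hB]; exact h
  have horth : b.orthogonal S = formOrthogonal B S := rfl
  rw [← horth]
  refine LinearMap.BilinForm.isCompl_orthogonal_of_restrict_nondegenerate hrefl ?_
  have h1 : ∀ v : S, (∀ w : S, B v w = 0) → v = 0 := fun v hv ↦
    Subtype.ext (hS v v.2 fun w hw ↦ hv ⟨w, hw⟩)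
  exact ⟨fun v hv ↦ h1 v hv, fun v hv ↦ h1 v fun w ↦ (hB _ _).trans (hv w)⟩

/-- `B₀` is the horizontal part of `B` with respect to `S`: it agrees with `B` on the orthogonal
complement of `S` and has `S` in its radical. For `S = 𝔥` this is the pull-back to `𝔤` of the form
on the tangent space of the coset space. -/
structure IsHorizontalPart (B : V →L[ℝ] V →L[ℝ] ℝ) (S : Submodule ℝ V)
    (B₀ : V →L[ℝ] V →L[ℝ] ℝ) : Prop where
  left : ∀ v ∈ S, ∀ w, B₀ v w = 0
  right : ∀ v, ∀ w ∈ S, B₀ v w = 0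
  eq : ∀ v ∈ formOrthogonal B S, ∀ w ∈ formOrthogonal B S, B₀ v w = B v w

theorem exists_isHorizontalPart [FiniteDimensional ℝ V] [IsTopologicalAddGroup V]
    [ContinuousSMul ℝ V] [T2Space V] {B : V →L[ℝ] V →L[ℝ] ℝ} (hB : FormSymm B)
    {S : Submodule ℝ V} (hS : FormNondegenerateOn B S) : ∃ B₀, IsHorizontalPart B S B₀ := by
  have hc := (isCompl_formOrthogonal hB hS).symm
  let P : V →L[ℝ] V := (Submodule.projection _ _ hc).toContinuousLinearMap
  have hPS : ∀ v ∈ S, P v = 0 := fun v hv ↦ (Submodule.projection_apply_eq_zero_iff hc).2 hv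
  have hPO : ∀ v ∈ formOrthogonal B S, P v = v := fun v hv ↦
    (Submodule.projection_eq_self_iff hc v).2 hv
  refine ⟨(ContinuousLinearMap.precomp ℝ P).comp (B.comp P), fun v hv w ↦ ?_, fun v w hw ↦ ?_,
    fun v hv w hw ↦ ?_⟩
  · change B (P v) (P w) = 0
    simp [hPS v hv]
  · change B (P v) (P w) = 0
    simp [hPS w hw]
  · change B (P v) (P w) = B v w
    rw [hPO v hv, hPO w hw]

theorem exists_add_mem_formOrthogonal [FiniteDimensional ℝ V] {B : V →L[ℝ] V →L[ℝ] ℝ}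
    (hB : FormSymm B) {S : Submodule ℝ V} (hS : FormNondegenerateOn B S) (v : V) :
    ∃ s ∈ S, ∃ t ∈ formOrthogonal B S, s + t = v :=
  Submodule.mem_sup.1 ((isCompl_formOrthogonal hB hS).sup_eq_top ▸ Submodule.mem_top)

theorem IsHorizontalPart.apply_add {B B₀ : V →L[ℝ] V →L[ℝ] ℝ} {S : Submodule ℝ V}
    (h : IsHorizontalPart B S B₀) {s t s' t' : V} (hs : s ∈ S) (ht : t ∈ formOrthogonal B S)
    (hs' : s' ∈ S) (ht' : t' ∈ formOrthogonal B S) : B₀ (s + t) (s' + t') = B t t' := by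
  simp [h.left s hs, h.right t s' hs', h.eq t ht t' ht']

theorem IsHorizontalPart.congr {B B₀ : V →L[ℝ] V →L[ℝ] ℝ} {S : Submodule ℝ V}
    (h : IsHorizontalPart B S B₀) {v v' w w' : V} (hv : v - v' ∈ S) (hw : w - w' ∈ S) :
    B₀ v w = B₀ v' w' := by
  have h1 := h.left _ hv w
  have h2 := h.right v' _ hw
  rw [map_sub, sub_apply, sub_eq_zero] at h1
  rw [map_sub, sub_eq_zero] at h2
  exact h1.trans h2

theorem IsHorizontalPart.symm [FiniteDimensional ℝ V] {B B₀ : V →L[ℝ] V →L[ℝ] ℝ}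
    {S : Submodule ℝ V} (h : IsHorizontalPart B S B₀) (hB : FormSymm B)
    (hS : FormNondegenerateOn B S) : FormSymm B₀ := by
  intro v w
  obtain ⟨s, hs, t, ht, rfl⟩ := exists_add_mem_formOrthogonal hB hS v
  obtain ⟨s', hs', t', ht', rfl⟩ := exists_add_mem_formOrthogonal hB hS w
  rw [h.apply_add hs ht hs' ht', h.apply_add hs' ht' hs ht, hB]

/-- The radical of the horizontal part of a non-degenerate form is not larger than `S`. -/
theorem IsHorizontalPart.mem_of_forall [FiniteDimensional ℝ V] {B B₀ : V →L[ℝ] V →L[ℝ] ℝ}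
    {S : Submodule ℝ V} (h : IsHorizontalPart B S B₀) (hB : FormSymm B)
    (hnd : FormNondegenerateOn B ⊤) (hS : FormNondegenerateOn B S) {v : V}
    (hv : ∀ w, B₀ v w = 0) : v ∈ S := by
  obtain ⟨s, hs, t, ht, rfl⟩ := exists_add_mem_formOrthogonal hB hS v
  have ht0 : t = 0 := by
    refine hnd t trivial fun w _ ↦ ?_
    obtain ⟨s', hs', t', ht', rfl⟩ := exists_add_mem_formOrthogonal hB hS w
    rw [map_add, hB t s', ht s' hs', zero_add, ← h.apply_add hs ht hs' ht']
    exact hv _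
  rw [ht0, add_zero]
  exact hs

theorem IsHorizontalPart.pos [FiniteDimensional ℝ V] {B B₀ : V →L[ℝ] V →L[ℝ] ℝ}
    {S : Submodule ℝ V} (h : IsHorizontalPart B S B₀) (hB : FormSymm B) (hpos : FormPosDef B)
    (hS : FormNondegenerateOn B S) {v : V} (hv : v ∉ S) : 0 < B₀ v v := by
  obtain ⟨s, hs, t, ht, rfl⟩ := exists_add_mem_formOrthogonal hB hS v
  rw [h.apply_add hs ht hs ht]
  refine hpos t ?_
  rintro rfl
  exact hv (by simpa using hs)

end LinearAlgebra

/-! ### Differentials of translations -/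

section Translations

variable {E : Type*} [NormedAddCommGroup E] [NormedSpace ℝ E]
  {K : Type*} [TopologicalSpace K] (I : ModelWithCorners ℝ E K)
  {G : Type*} [TopologicalSpace G] [ChartedSpace K G] [Group G] [LieGroup I ∞ G]

theorem LieGroup.mdifferentiableAt_mul_left (a x : G) :
    MDifferentiableAt I I (fun y : G ↦ a * y) x :=
  ((contMDiff_mul_left (I := I) (n := ∞) (a := a)) x).mdifferentiableAt (by simp)

theorem LieGroup.mdifferentiableAt_conj (a x : G) :
    MDifferentiableAt I I (fun y : G ↦ a * y * a⁻¹) x := by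
  have h : ContMDiff I I ∞ fun y : G ↦ a * y * a⁻¹ :=
    (contMDiff_const.mul contMDiff_id).mul contMDiff_const
  exact (h x).mdifferentiableAt (by simp)

theorem leftDerivInv_leftDeriv (x : G) (v : GroupLieAlgebra I G) :
    leftDerivInv I x (leftDeriv I x v) = v := by
  have h := mfderiv_comp_apply_of_eq (1 : G) (LieGroup.mdifferentiableAt_mul_left I x⁻¹ x)
    (LieGroup.mdifferentiableAt_mul_left I x 1) (mul_one x) v
  have e : (fun y : G ↦ x⁻¹ * y) ∘ (fun y : G ↦ x * y) = id := by ext; simp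
  rw [e, mfderiv_id] at h
  exact h.symm

theorem leftDeriv_leftDerivInv (x : G) (v : TangentSpace I x) :
    leftDeriv I x (leftDerivInv I x v) = v := by
  have h := mfderiv_comp_apply_of_eq x (LieGroup.mdifferentiableAt_mul_left I x 1)
    (LieGroup.mdifferentiableAt_mul_left I x⁻¹ x) (inv_mul_cancel x) v
  have e : (fun y : G ↦ x * y) ∘ (fun y : G ↦ x⁻¹ * y) = id := by ext; simp
  rw [e, mfderiv_id] at h
  exact h.symm

theorem leftDerivInv_mfderiv_mul_left (a x : G) (v : TangentSpace I x) :
    leftDerivInv I (a * x) (mfderiv I I (fun y : G ↦ a * y) x v) = leftDerivInv I x v := by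
  have h := mfderiv_comp_apply_of_eq x (LieGroup.mdifferentiableAt_mul_left I (a * x)⁻¹ (a * x))
    (LieGroup.mdifferentiableAt_mul_left I a x) rfl v
  have e : (fun y : G ↦ (a * x)⁻¹ * y) ∘ (fun y : G ↦ a * y) = fun y ↦ x⁻¹ * y := by
    ext; simp [mul_assoc]
  rw [e] at h
  exact h.symm

theorem lieAd_lieAd_inv (a : G) (v : GroupLieAlgebra I G) : lieAd I a (lieAd I a⁻¹ v) = v := by
  have h := mfderiv_comp_apply_of_eq (1 : G) (LieGroup.mdifferentiableAt_conj I a 1)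
    (LieGroup.mdifferentiableAt_conj I a⁻¹ 1) (by simp) v
  have e : (fun y : G ↦ a * y * a⁻¹) ∘ (fun y : G ↦ a⁻¹ * y * a⁻¹⁻¹) = id := by
    ext; simp [mul_assoc]
  rw [e, mfderiv_id] at h
  exact h.symm

end Translations

theorem IsSmoothSubmersion.mdifferentiableAt {E K M E' K' N : Type*} [NormedAddCommGroup E]
    [NormedSpace ℝ E] [TopologicalSpace K] {I : ModelWithCorners ℝ E K} [TopologicalSpace M]
    [ChartedSpace K M] [NormedAddCommGroup E'] [NormedSpace ℝ E'] [TopologicalSpace K']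
    {I' : ModelWithCorners ℝ E' K'} [TopologicalSpace N] [ChartedSpace K' N] {f : M → N}
    (hf : IsSmoothSubmersion I I' f) (x : M) : MDifferentiableAt I I' f x :=
  (hf.smooth x).mdifferentiableAt (by simp)

section CosetTranslations

variable {E : Type*} [NormedAddCommGroup E] [NormedSpace ℝ E]
  {K : Type*} [TopologicalSpace K] {I : ModelWithCorners ℝ E K} [I.Boundaryless]
  {G : Type*} [TopologicalSpace G] [ChartedSpace K G] [Group G] [LieGroup I ∞ G]
  {H : Subgroup G}
  {F : Type*} [NormedAddCommGroup F] [NormedSpace ℝ F] [FiniteDimensional ℝ F]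
  [ChartedSpace F (G ⧸ H)] [IsManifold 𝓘(ℝ, F) ∞ (G ⧸ H)]
  (hπ : IsSmoothSubmersion I 𝓘(ℝ, F) (fun x : G ↦ (x : G ⧸ H)))

include hπ

theorem mdifferentiableAt_smul (a : G) (p : G ⧸ H) :
    MDifferentiableAt 𝓘(ℝ, F) 𝓘(ℝ, F) (fun q : G ⧸ H ↦ a • q) p :=
  (contMDiff_smul_of_isSmoothSubmersion hπ a p).mdifferentiableAt (by simp)

theorem mfderiv_smul_smul (a b : G) (p : G ⧸ H) (v : F) :
    (mfderiv 𝓘(ℝ, F) 𝓘(ℝ, F) (fun q : G ⧸ H ↦ (a * b) • q) p v : F) =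
      mfderiv 𝓘(ℝ, F) 𝓘(ℝ, F) (fun q : G ⧸ H ↦ a • q) (b • p)
        (mfderiv 𝓘(ℝ, F) 𝓘(ℝ, F) (fun q : G ⧸ H ↦ b • q) p v) := by
  have h := mfderiv_comp_apply_of_eq p (mdifferentiableAt_smul hπ a (b • p))
    (mdifferentiableAt_smul hπ b p) rfl v
  have e : (fun q : G ⧸ H ↦ a • q) ∘ (fun q : G ⧸ H ↦ b • q) = fun q ↦ (a * b) • q := by
    ext q; simp [mul_smul]
  rw [e] at h
  exact h

theorem mfderiv_smul_injective (a : G) (p : G ⧸ H) {v w : F}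
    (h : (mfderiv 𝓘(ℝ, F) 𝓘(ℝ, F) (fun q : G ⧸ H ↦ a • q) p v : F) =
      mfderiv 𝓘(ℝ, F) 𝓘(ℝ, F) (fun q : G ⧸ H ↦ a • q) p w) : v = w := by
  have e : (fun q : G ⧸ H ↦ (a⁻¹ * a) • q) = id := by ext q; simp
  have h1 : ∀ u : F, (mfderiv 𝓘(ℝ, F) 𝓘(ℝ, F) (fun q : G ⧸ H ↦ (a⁻¹ * a) • q) p u : F) = u := by
    intro u
    rw [e, mfderiv_id]
    rfl
  rw [← h1 v, ← h1 w, mfderiv_smul_smul hπ, mfderiv_smul_smul hπ, h]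

theorem mfderiv_smul_mk (a x : G) (v : E) :
    (mfderiv 𝓘(ℝ, F) 𝓘(ℝ, F) (fun q : G ⧸ H ↦ a • q) (x : G ⧸ H)
      (mfderiv I 𝓘(ℝ, F) (fun x : G ↦ (x : G ⧸ H)) x v) : F) =
      mfderiv I 𝓘(ℝ, F) (fun x : G ↦ (x : G ⧸ H)) (a * x)
        (mfderiv I I (fun y : G ↦ a * y) x v) := by
  have h1 := mfderiv_comp_apply_of_eq x (mdifferentiableAt_smul hπ a (x : G ⧸ H))
    (hπ.mdifferentiableAt x) rfl v
  have h2 := mfderiv_comp_apply_of_eq x (hπ.mdifferentiableAt (a * x))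
    (LieGroup.mdifferentiableAt_mul_left I a x) rfl v
  exact h1.symm.trans h2

/-- The differential of the projection at `x`, in terms of its differential at `1`. -/
theorem mfderiv_mk_eq (x : G) (v : E) :
    (mfderiv I 𝓘(ℝ, F) (fun x : G ↦ (x : G ⧸ H)) x v : F) =
      mfderiv 𝓘(ℝ, F) 𝓘(ℝ, F) (fun q : G ⧸ H ↦ x • q) ((1 : G) : G ⧸ H)
        (mfderiv I 𝓘(ℝ, F) (fun x : G ↦ (x : G ⧸ H)) 1 (leftDerivInv I x v)) := by
  have h1 := mfderiv_smul_mk hπ x 1 (leftDerivInv I x v)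
  refine Eq.trans ?_ h1.symm
  -- `x * 1` and `x` are equal, but the tangent spaces at these points are not syntactically so
  have h2 : ∀ z : G, z = x → (mfderiv I 𝓘(ℝ, F) (fun x : G ↦ (x : G ⧸ H)) x v : F) =
      mfderiv I 𝓘(ℝ, F) (fun x : G ↦ (x : G ⧸ H)) z (v : E) := by rintro _ rfl; rfl
  refine (h2 (x * 1) (mul_one x)).trans ?_
  exact congrArg (mfderiv I 𝓘(ℝ, F) (fun x : G ↦ (x : G ⧸ H)) (x * 1))
    (leftDeriv_leftDerivInv I x v).symm

/-- At `1`, the adjoint action of `h ∈ H` on `𝔤` covers the action of `h` on the tangent space of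
the coset space. -/
theorem mfderiv_mk_lieAd {h : G} (hh : h ∈ H) (v : E) :
    (mfderiv I 𝓘(ℝ, F) (fun x : G ↦ (x : G ⧸ H)) 1 (lieAd I h v) : F) =
      mfderiv 𝓘(ℝ, F) 𝓘(ℝ, F) (fun q : G ⧸ H ↦ h • q) ((1 : G) : G ⧸ H)
        (mfderiv I 𝓘(ℝ, F) (fun x : G ↦ (x : G ⧸ H)) 1 v) := by
  have h1 := mfderiv_comp_apply_of_eq (1 : G) (mdifferentiableAt_smul hπ h ((1 : G) : G ⧸ H))
    (hπ.mdifferentiableAt 1) rfl v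
  have h2 := mfderiv_comp_apply_of_eq (1 : G) (hπ.mdifferentiableAt 1)
    (LieGroup.mdifferentiableAt_conj I h 1) (by simp) v
  have e : (fun x : G ↦ (x : G ⧸ H)) ∘ (fun y : G ↦ h * y * h⁻¹) =
      (fun q : G ⧸ H ↦ h • q) ∘ (fun x : G ↦ (x : G ⧸ H)) := by
    ext y
    exact QuotientGroup.mk_mul_of_mem _ (H.inv_mem hh)
  rw [e] at h2
  exact h2.symm.trans h1

end CosetTranslations

/-! ### Smoothness of tensor fields -/

section Smoothness

variable {E : Type*} [NormedAddCommGroup E] [NormedSpace ℝ E]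
  {K : Type*} [TopologicalSpace K] {I : ModelWithCorners ℝ E K}
  {M : Type*} [TopologicalSpace M] [ChartedSpace K M] [IsManifold I ∞ M]
  {E' : Type*} [NormedAddCommGroup E'] [NormedSpace ℝ E']
  {K' : Type*} [TopologicalSpace K'] {I' : ModelWithCorners ℝ E' K'}
  {N : Type*} [TopologicalSpace N] [ChartedSpace K' N] [IsManifold I' ∞ N]

/-- In the trivialization of the tangent bundle at `z`, the fibre over `z` is the model space. -/
theorem TangentBundle.continuousLinearMapAt_self {z z' : M} (h : z' = z) (u : E) :
    ((trivializationAt E (TangentSpace I) z).continuousLinearMapAt ℝ z' u : E) = u := by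
  subst h
  have e := TangentBundle.continuousLinearMapAt_trivializationAt_eq_core (I := I)
    (mem_chart_source K z')
  exact (DFunLike.congr_fun e u).trans
    ((tangentBundleCore I M).coordChange_self _ _ (mem_chart_source K z') u)

/-- The partial differential along the diagonal of a smooth map `N × N → M` which is constant on
the diagonal depends smoothly on the point, in a trivialization of the tangent bundle of `N`. -/
theorem exists_contMDiffAt_mfderiv_diag {f : N → N → M} {p₀ : N} {y : M}
    (hf : ContMDiffAt (I'.prod I') I ∞ (Function.uncurry f) (p₀, p₀))
    (hy : ∀ᶠ p in 𝓝 p₀, f p p = y) :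
    ∃ C : N → E' →L[ℝ] E, ContMDiffAt I' 𝓘(ℝ, E' →L[ℝ] E) ∞ C p₀ ∧
      ∀ᶠ p in 𝓝 p₀, ∀ v : E', C p v =
        (mfderiv I' I (f p) p ((trivializationAt E' (TangentSpace I') p₀).symmL ℝ p v) : E) := by
  refine ⟨_, ContMDiffAt.mfderiv (m := ∞) f id hf contMDiffAt_id (by simp), ?_⟩
  filter_upwards [hy] with p hp v
  exact TangentBundle.continuousLinearMapAt_self (hp.trans hy.self_of_nhds.symm) _

/-- A field of bilinear forms is smooth if it is, locally, the pull-back of a fixed form by the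
differentials of a smooth family of maps. -/
theorem contMDiffAt_form {f : N → N → M} {p₀ : N} {y : M}
    (hf : ContMDiffAt (I'.prod I') I ∞ (Function.uncurry f) (p₀, p₀))
    (hy : ∀ᶠ p in 𝓝 p₀, f p p = y) (B : E →L[ℝ] E →L[ℝ] ℝ)
    (g : ∀ x : N, TangentSpace I' x →L[ℝ] TangentSpace I' x →L[ℝ] ℝ)
    (hg : ∀ᶠ p in 𝓝 p₀, ∀ v w : E', g p v w =
      B (mfderiv I' I (f p) p v : E) (mfderiv I' I (f p) p w : E)) :
    ContMDiffAt I' (I'.prod 𝓘(ℝ, E' →L[ℝ] E' →L[ℝ] ℝ)) ∞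
    (fun x : N ↦ Bundle.TotalSpace.mk' (E' →L[ℝ] E' →L[ℝ] ℝ)
      (E := fun x : N ↦ TangentSpace I' x →L[ℝ] TangentSpace I' x →L[ℝ] ℝ) x (g x)) p₀ := by
  rw [contMDiffAt_hom_bundle]
  refine ⟨contMDiffAt_id, ?_⟩
  obtain ⟨C, hC, hCeq⟩ := exists_contMDiffAt_mfderiv_diag hf hy
  have hpre := hC.clm_precomp (F₃ := ℝ)
  refine (hpre.clm_comp ((contMDiffAt_const (c := B)).clm_comp hC)).congr_of_eventuallyEq ?_
  filter_upwards [hg, hCeq, (chartAt K' p₀).open_source.mem_nhds (mem_chart_source K' p₀)]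
    with p hp hCp hps
  ext v w
  have hb : p ∈ (trivializationAt E' (TangentSpace I') p₀).baseSet := hps
  refine (inCoordinates_apply_eq₂ (F₃ := ℝ) (E₃ := fun _ : N ↦ ℝ) hb hb (mem_univ p)).trans ?_
  have htriv : ∀ r : ℝ, (trivializationAt ℝ (fun _ : N ↦ ℝ) p₀).linearMapAt ℝ p r = r :=
    fun r ↦ DFunLike.congr_fun (Bundle.Trivial.linearMapAt_trivialization ℝ N ℝ p) r
  refine (htriv _).trans ?_
  change _ = B (C p v) (C p w)
  rw [hCp, hCp]
  have hs : ∀ u : E', ((trivializationAt E' (TangentSpace I') p₀).symm p u : E') =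
      (trivializationAt E' (TangentSpace I') p₀).symmL ℝ p u := fun u ↦
    (Bundle.Trivialization.symmL_apply _ hb _).symm
  exact (congrArg₂ (fun a b : E' ↦ g p a b) (hs v) (hs w)).trans (hp _ _)

/-- A field of endomorphisms is smooth if it is, locally, obtained from a fixed endomorphism by
conjugation with the differentials of smooth families of maps. -/
theorem contMDiffAt_endomorphism {f : N → N → M} {f' : N → M → N} {p₀ : N} {y : M}
    (hf : ContMDiffAt (I'.prod I') I ∞ (Function.uncurry f) (p₀, p₀))
    (hf' : ContMDiffAt (I'.prod I) I' ∞ (Function.uncurry f') (p₀, y))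
    (hy : ∀ᶠ p in 𝓝 p₀, f p p = y) (hy' : ∀ᶠ p in 𝓝 p₀, f' p y = p) (J : E →L[ℝ] E)
    (T : ∀ x : N, TangentSpace I' x →L[ℝ] TangentSpace I' x)
    (hT : ∀ᶠ p in 𝓝 p₀, ∀ v : E', (T p v : E') =
      mfderiv I I' (f' p) y (J (mfderiv I' I (f p) p v : E))) :
    ContMDiffAt I' (I'.prod 𝓘(ℝ, E' →L[ℝ] E')) ∞
    (fun x : N ↦ Bundle.TotalSpace.mk' (E' →L[ℝ] E')
      (E := fun x : N ↦ TangentSpace I' x →L[ℝ] TangentSpace I' x) x (T x)) p₀ := by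
  rw [contMDiffAt_hom_bundle]
  refine ⟨contMDiffAt_id, ?_⟩
  obtain ⟨C, hC, hCeq⟩ := exists_contMDiffAt_mfderiv_diag hf hy
  have hA := ContMDiffAt.mfderiv (m := ∞) f' (fun _ ↦ y) hf' contMDiffAt_const (by simp)
  refine (hA.clm_comp ((contMDiffAt_const (c := J)).clm_comp hC)).congr_of_eventuallyEq ?_
  filter_upwards [hT, hCeq, hy'] with p hp hCp hy'p
  have hy'p₀ := hy'.self_of_nhds
  ext v
  -- Both sides are written in the trivialization of the tangent bundle of `N` at `p₀`.
  have key : ∀ z z₀ : N, z = p → z₀ = p₀ → ∀ u : E',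
      ((trivializationAt E' (TangentSpace I') p₀).continuousLinearMapAt ℝ p u : E') =
        (trivializationAt E' (TangentSpace I') z₀).continuousLinearMapAt ℝ z (u : E') := by
    rintro _ _ rfl rfl u
    rfl
  have e1 := congrArg (fun u : E ↦ (mfderiv I I' (f' p) y (J u) : E')) (hCp v).symm
  have e2 : ((trivializationAt E (TangentSpace I) y).symmL ℝ y (J (C p v)) : E) = J (C p v) := by
    have e := TangentBundle.symmL_trivializationAt_eq_core (I := I) (mem_chart_source K y)
    exact (DFunLike.congr_fun e _).trans
      ((tangentBundleCore I M).coordChange_self _ _ (mem_chart_source K y) _)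
  have e3 := ((hp _).trans e1).trans (congrArg (fun u : E ↦ (mfderiv I I' (f' p) y u : E')) e2.symm)
  exact (key _ _ hy'p hy'p₀ _).trans (congrArg
    ((trivializationAt E' (TangentSpace I') (f' p₀ y)).continuousLinearMapAt ℝ (f' p y)) e3)

end Smoothness

section InvariantFields

variable {E : Type*} [NormedAddCommGroup E] [NormedSpace ℝ E]
  {K : Type*} [TopologicalSpace K] (I : ModelWithCorners ℝ E K)
  {G : Type*} [TopologicalSpace G] [ChartedSpace K G] [Group G] [LieGroup I ∞ G]

theorem contMDiffAt_uncurry_inv_mul (x y : G) :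
    ContMDiffAt (I.prod I) I ∞ (Function.uncurry fun x y : G ↦ x⁻¹ * y) (x, y) :=
  ((contMDiff_fst.inv).mul contMDiff_snd).contMDiffAt

theorem contMDiff_leftInvariantForm (B : GroupLieAlgebra I G →L[ℝ] GroupLieAlgebra I G →L[ℝ] ℝ) :
    ContMDiff I (I.prod 𝓘(ℝ, E →L[ℝ] E →L[ℝ] ℝ)) ∞
      (fun x : G ↦ Bundle.TotalSpace.mk' (E →L[ℝ] E →L[ℝ] ℝ)
        (E := fun x : G ↦ TangentSpace I x →L[ℝ] TangentSpace I x →L[ℝ] ℝ) x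
        (leftInvariantForm I B x)) := fun x ↦
  contMDiffAt_form (f := fun x y ↦ x⁻¹ * y) (y := 1) (contMDiffAt_uncurry_inv_mul I x x)
    (.of_forall inv_mul_cancel) B _ (.of_forall fun _ _ _ ↦ rfl)

theorem isSmoothEndomorphism_leftInvariantEndo
    (J : GroupLieAlgebra I G →L[ℝ] GroupLieAlgebra I G) :
    IsSmoothEndomorphism I (leftInvariantEndo I J : ∀ _ : G, _) := fun x ↦
  contMDiffAt_endomorphism (f := fun x y ↦ x⁻¹ * y) (f' := fun x y ↦ x * y) (y := 1)
    (contMDiffAt_uncurry_inv_mul I x x) (contMDiff_fst.mul contMDiff_snd).contMDiffAt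
    (.of_forall inv_mul_cancel) (.of_forall mul_one) J _ (.of_forall fun _ _ ↦ rfl)

variable {I} [I.Boundaryless] {H : Subgroup G}
  {F : Type*} [NormedAddCommGroup F] [NormedSpace ℝ F] [FiniteDimensional ℝ F]
  [ChartedSpace F (G ⧸ H)] [IsManifold 𝓘(ℝ, F) ∞ (G ⧸ H)]

/-- A field of bilinear forms on the coset space is smooth if its pull-back to the group is
left-invariant: near a point it is pulled back from the Lie algebra by a local section. -/
theorem contMDiff_of_pullback_eq_leftInvariantForm
    (hπ : IsSmoothSubmersion I 𝓘(ℝ, F) (fun x : G ↦ (x : G ⧸ H)))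
    {B : GroupLieAlgebra I G →L[ℝ] GroupLieAlgebra I G →L[ℝ] ℝ}
    {g : ∀ p : G ⧸ H, TangentSpace 𝓘(ℝ, F) p →L[ℝ] TangentSpace 𝓘(ℝ, F) p →L[ℝ] ℝ}
    (hg : ∀ (x : G) (v w : TangentSpace I x),
      g (x : G ⧸ H) (mfderiv I 𝓘(ℝ, F) (fun x : G ↦ (x : G ⧸ H)) x v)
        (mfderiv I 𝓘(ℝ, F) (fun x : G ↦ (x : G ⧸ H)) x w) = leftInvariantForm I B x v w) :
    ContMDiff 𝓘(ℝ, F) (𝓘(ℝ, F).prod 𝓘(ℝ, F →L[ℝ] F →L[ℝ] ℝ)) ∞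
      (fun p : G ⧸ H ↦ Bundle.TotalSpace.mk' (F →L[ℝ] F →L[ℝ] ℝ)
        (E := fun p : G ⧸ H ↦ TangentSpace 𝓘(ℝ, F) p →L[ℝ] TangentSpace 𝓘(ℝ, F) p →L[ℝ] ℝ)
        p (g p)) := by
  intro p₀
  obtain ⟨x₀, rfl⟩ := QuotientGroup.mk_surjective p₀
  obtain ⟨τ, V, hVo, hxV, hτ, -, hτV⟩ := hπ.exists_local_section x₀
  have hτat : ∀ p ∈ V, ContMDiffAt 𝓘(ℝ, F) I ∞ τ p := fun p hp ↦
    hτ.contMDiffAt (hVo.mem_nhds hp)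
  refine contMDiffAt_form (I := I) (f := fun p q ↦ (τ p)⁻¹ * τ q) (y := (1 : G)) ?_
    (.of_forall fun p ↦ inv_mul_cancel (τ p)) B g ?_
  · have h1 : ContMDiffAt (𝓘(ℝ, F).prod 𝓘(ℝ, F)) I ∞ (fun z : (G ⧸ H) × (G ⧸ H) ↦ τ z.1)
        ((x₀ : G ⧸ H), (x₀ : G ⧸ H)) :=
      ContMDiffAt.comp (f := Prod.fst) (g := τ) (I' := 𝓘(ℝ, F)) _ (hτat _ hxV) contMDiffAt_fst
    have h2 : ContMDiffAt (𝓘(ℝ, F).prod 𝓘(ℝ, F)) I ∞ (fun z : (G ⧸ H) × (G ⧸ H) ↦ τ z.2)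
        ((x₀ : G ⧸ H), (x₀ : G ⧸ H)) :=
      ContMDiffAt.comp (f := Prod.snd) (g := τ) (I' := 𝓘(ℝ, F)) _ (hτat _ hxV) contMDiffAt_snd
    exact h1.inv.mul h2
  · filter_upwards [hVo.mem_nhds hxV] with p hp v w
    have hτp : MDifferentiableAt 𝓘(ℝ, F) I τ p := (hτat p hp).mdifferentiableAt (by simp)
    have e1 : ∀ u : F, (mfderiv I 𝓘(ℝ, F) (fun x : G ↦ (x : G ⧸ H)) (τ p)
        (mfderiv 𝓘(ℝ, F) I τ p u) : F) = u := by
      intro u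
      have h := mfderiv_comp_apply_of_eq p (hπ.mdifferentiableAt (τ p)) hτp rfl u
      have h' : (fun x : G ↦ (x : G ⧸ H)) ∘ τ =ᶠ[𝓝 p] id := by
        filter_upwards [hVo.mem_nhds hp] with q hq
        exact hτV q hq
      refine h.symm.trans ?_
      rw [h'.mfderiv_eq, mfderiv_id]
      rfl
    have e2 : ∀ u : F, (mfderiv 𝓘(ℝ, F) I (fun q ↦ (τ p)⁻¹ * τ q) p u : E) =
        leftDerivInv I (τ p) (mfderiv 𝓘(ℝ, F) I τ p u) := fun u ↦
      mfderiv_comp_apply_of_eq p (LieGroup.mdifferentiableAt_mul_left I (τ p)⁻¹ (τ p)) hτp rfl u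
    -- transport of `g` along the equality of the points `τ p : G ⧸ H` and `p`
    have e3 : ∀ z : G ⧸ H, z = p → ∀ v w : F, g p v w = g z (v : F) (w : F) := by
      rintro _ rfl _ _; rfl
    have e4 := hg (τ p) (mfderiv 𝓘(ℝ, F) I τ p v) (mfderiv 𝓘(ℝ, F) I τ p w)
    have e5 : g (τ p : G ⧸ H) (v : F) (w : F) = leftInvariantForm I B (τ p)
        (mfderiv 𝓘(ℝ, F) I τ p v) (mfderiv 𝓘(ℝ, F) I τ p w) := by
      refine Eq.trans ?_ e4
      exact congrArg₂ (fun a b : F ↦ g (τ p : G ⧸ H) a b) (e1 v).symm (e1 w).symm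
    refine (e3 _ (hτV p hp) v w).trans (e5.trans ?_)
    exact congrArg₂ (fun a b : E ↦ B a b) (e2 v).symm (e2 w).symm

end InvariantFields

/-! ### The Lagrangian condition for subspaces -/

section LinearAlgebra

variable {V : Type*} [AddCommGroup V] [Module ℝ V] [TopologicalSpace V]

/-- The Lagrangian condition is a matter of dimensions, since `S` and its orthogonal complement have
complementary dimensions. -/
theorem map_eq_formOrthogonal_iff [FiniteDimensional ℝ V] {B : V →L[ℝ] V →L[ℝ] ℝ}
    (hB : FormSymm B) {S : Submodule ℝ V} (hS : FormNondegenerateOn B S) {J : V →L[ℝ] V}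
    (hJ : Function.Injective J) (hJS : ∀ v ∈ S, J v ∈ formOrthogonal B S) :
    S.map J.toLinearMap = formOrthogonal B S ↔
      2 * Module.finrank ℝ S = Module.finrank ℝ V := by
  have h1 := Submodule.finrank_add_eq_of_isCompl (isCompl_formOrthogonal hB hS)
  have h2 : Module.finrank ℝ (S.map J.toLinearMap) = Module.finrank ℝ S :=
    (LinearEquiv.finrank_eq (Submodule.equivMapOfInjective J.toLinearMap hJ S)).symm
  constructor
  · intro h
    rw [h] at h2
    omega
  · intro h
    refine Submodule.eq_of_le_of_finrank_eq ?_ (by omega)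
    rintro _ ⟨v, hv, rfl⟩
    exact hJS v hv

theorem IsHermitianComplex.injective {B : V →L[ℝ] V →L[ℝ] ℝ} {J : V →L[ℝ] V}
    (h : IsHermitianComplex B J) : Function.Injective J := fun v w hvw ↦ by
  have := congrArg J hvw
  rwa [h.sq, h.sq, neg_inj] at this

theorem IsHermitianParaComplex.injective {B : V →L[ℝ] V →L[ℝ] ℝ} {J : V →L[ℝ] V}
    (h : IsHermitianParaComplex B J) : Function.Injective J := fun v w hvw ↦ by
  have := congrArg J hvw
  rwa [h.sq, h.sq] at this

end LinearAlgebra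

/-! ### Left-invariant tensor fields -/

section LeftInvariant

variable {E : Type*} [NormedAddCommGroup E] [NormedSpace ℝ E]
  {K : Type*} [TopologicalSpace K] (I : ModelWithCorners ℝ E K)
  {G : Type*} [TopologicalSpace G] [ChartedSpace K G] [Group G]

theorem leftDerivInv_one (v : GroupLieAlgebra I G) : leftDerivInv I (1 : G) v = v := by
  have e : (fun y : G ↦ (1 : G)⁻¹ * y) = id := by ext; simp
  rw [leftDerivInv, e, mfderiv_id]
  rfl

theorem leftInvariantForm_apply (B : GroupLieAlgebra I G →L[ℝ] GroupLieAlgebra I G →L[ℝ] ℝ)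
    (x : G) (v w : TangentSpace I x) :
    leftInvariantForm I B x v w = B (leftDerivInv I x v) (leftDerivInv I x w) :=
  rfl

theorem leftInvariantEndo_apply (J : GroupLieAlgebra I G →L[ℝ] GroupLieAlgebra I G)
    (x : G) (v : TangentSpace I x) :
    leftInvariantEndo I J x v = leftDeriv I x (J (leftDerivInv I x v)) :=
  rfl

variable [LieGroup I ∞ G]

/-- Left translation identifies the Lie algebra with the tangent space at `x`. -/
def leftDerivEquiv (x : G) : GroupLieAlgebra I G ≃ₗ[ℝ] TangentSpace I x :=
  LinearEquiv.ofLinearMap (leftDeriv I x).toLinearMap (leftDerivInv I x).toLinearMap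
    (LinearMap.ext (leftDeriv_leftDerivInv I x)) (LinearMap.ext (leftDerivInv_leftDeriv I x))

theorem leftDerivInv_leftInvariantEndo (J : GroupLieAlgebra I G →L[ℝ] GroupLieAlgebra I G)
    (x : G) (v : TangentSpace I x) :
    leftDerivInv I x (leftInvariantEndo I J x v) = J (leftDerivInv I x v) :=
  leftDerivInv_leftDeriv I x _

theorem leftDerivInv_injective (x : G) : Function.Injective (leftDerivInv I x) :=
  (leftDerivEquiv I x).symm.injective

variable {I}
variable {B : GroupLieAlgebra I G →L[ℝ] GroupLieAlgebra I G →L[ℝ] ℝ}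

theorem FormPosDef.leftInvariantForm (h : FormPosDef B) (x : G) :
    FormPosDef (leftInvariantForm I B x) := fun _ hv ↦
  h _ fun h0 ↦ hv (leftDerivInv_injective I x (h0.trans (map_zero _).symm))

theorem FormNeutral.leftInvariantForm (h : FormNeutral B) (x : G) :
    FormNeutral (leftInvariantForm I B x) := by
  obtain ⟨P, N, hPN, hdim, hP, hN⟩ := h
  set e := leftDerivEquiv I x
  have he : ∀ u, _root_.leftInvariantForm I B x (e u) (e u) = B u u := fun u ↦
    congrArg₂ (fun a b ↦ B a b) (leftDerivInv_leftDeriv I x u) (leftDerivInv_leftDeriv I x u)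
  refine ⟨P.map e.toLinearMap, N.map e.toLinearMap,
    hPN.map (Submodule.orderIsoMapComap e), ?_, ?_, ?_⟩
  · rw [LinearEquiv.finrank_map_eq, LinearEquiv.finrank_map_eq, hdim]
  · rintro _ ⟨u, hu, rfl⟩ hne
    exact (hP u hu fun h0 ↦ hne (by rw [h0, map_zero])).trans_eq (he u).symm
  · rintro _ ⟨u, hu, rfl⟩ hne
    exact (he u).trans_lt (hN u hu fun h0 ↦ hne (by rw [h0, map_zero]))

theorem isPseudoRiemannianMetric_leftInvariantForm (hsymm : FormSymm B)
    (hnd : FormNondegenerateOn B ⊤) :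
    IsPseudoRiemannianMetric I (leftInvariantForm I B : ∀ _ : G, _) where
  symm _ _ _ := hsymm _ _
  nondegenerate x v _ h := by
    refine leftDerivInv_injective I x ((hnd _ trivial fun u _ ↦ ?_).trans (map_zero _).symm)
    have := h (leftDeriv I x u) trivial
    rwa [leftInvariantForm_apply, leftDerivInv_leftDeriv] at this
  smooth := contMDiff_leftInvariantForm I B

theorem IsHermitianComplex.leftInvariantEndo {J : GroupLieAlgebra I G →L[ℝ] GroupLieAlgebra I G}
    (h : IsHermitianComplex B J) (x : G) :
    IsHermitianComplex (leftInvariantForm I B x) (leftInvariantEndo I J x) where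
  sq v := leftDerivInv_injective I x <| by
    rw [leftDerivInv_leftInvariantEndo, leftDerivInv_leftInvariantEndo, h.sq, map_neg]
  compat v w := by
    rw [leftInvariantForm_apply, leftDerivInv_leftInvariantEndo, leftDerivInv_leftInvariantEndo,
      h.compat, leftInvariantForm_apply]

theorem IsHermitianParaComplex.leftInvariantEndo
    {J : GroupLieAlgebra I G →L[ℝ] GroupLieAlgebra I G}
    (h : IsHermitianParaComplex B J) (x : G) :
    IsHermitianParaComplex (leftInvariantForm I B x) (leftInvariantEndo I J x) where
  sq v := leftDerivInv_injective I x <| by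
    rw [leftDerivInv_leftInvariantEndo, leftDerivInv_leftInvariantEndo, h.sq]
  compat v w := by
    rw [leftInvariantForm_apply, leftDerivInv_leftInvariantEndo, leftDerivInv_leftInvariantEndo,
      h.compat, leftInvariantForm_apply]

theorem IsUnitalAction.leftInvariantEndo {A : Type*} [Ring A] [Algebra ℝ A]
    {ρ : A → GroupLieAlgebra I G →L[ℝ] GroupLieAlgebra I G} (h : IsUnitalAction ρ) (x : G) :
    IsUnitalAction fun a ↦ leftInvariantEndo I (ρ a) x where
  map_add a b v := by simp only [leftInvariantEndo_apply, h.map_add, _root_.map_add]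
  map_smul c a v := by simp only [leftInvariantEndo_apply, h.map_smul, _root_.map_smul]
  map_one v := by simp only [leftInvariantEndo_apply, h.map_one, leftDeriv_leftDerivInv]
  map_mul a b v := by
    simp only [leftInvariantEndo_apply, h.map_mul, leftDerivInv_leftDeriv]

theorem IsHermitianQuaternion.leftInvariantEndo
    {ρ : ℍ[ℝ] → GroupLieAlgebra I G →L[ℝ] GroupLieAlgebra I G}
    (h : IsHermitianQuaternion B ρ) (x : G) :
    IsHermitianQuaternion (leftInvariantForm I B x) fun q ↦ leftInvariantEndo I (ρ q) x where
  action := h.action.leftInvariantEndo x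
  norm_sq q v := by
    rw [leftInvariantForm_apply, leftDerivInv_leftInvariantEndo, h.norm_sq,
      leftInvariantForm_apply]

theorem IsHermitianParaQuaternion.leftInvariantEndo
    {ρ : ParaQuaternion → GroupLieAlgebra I G →L[ℝ] GroupLieAlgebra I G}
    (h : IsHermitianParaQuaternion B ρ) (x : G) :
    IsHermitianParaQuaternion (leftInvariantForm I B x) fun q ↦ leftInvariantEndo I (ρ q) x where
  action := h.action.leftInvariantEndo x
  herm₁ := h.herm₁.leftInvariantEndo x
  herm₂ := h.herm₂.leftInvariantEndo x
  herm₃ := h.herm₃.leftInvariantEndo x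

end LeftInvariant

/-! ### The adjoint action of the subgroup -/

section CosetMetric

variable {E : Type*} [NormedAddCommGroup E] [NormedSpace ℝ E] [FiniteDimensional ℝ E]
  {K : Type*} [TopologicalSpace K] {I : ModelWithCorners ℝ E K} [I.Boundaryless]
  {G : Type*} [TopologicalSpace G] [ChartedSpace K G] [Group G] [LieGroup I ∞ G]
  {H : Subgroup G} (hclosed : IsClosed (H : Set G))
  {F : Type*} [NormedAddCommGroup F] [NormedSpace ℝ F] [FiniteDimensional ℝ F]
  [ChartedSpace F (G ⧸ H)] [IsManifold 𝓘(ℝ, F) ∞ (G ⧸ H)]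
  (hπ : IsSmoothSubmersion I 𝓘(ℝ, F) (fun x : G ↦ (x : G ⧸ H)))

include hclosed hπ

/-- The Lie algebra of `H` is the kernel of the differential of the projection at `1`,
which is equivariant for the action of `H`. -/
theorem lieAd_mem_subgroupLieAlgebra {h : G} (hh : h ∈ H) {v : GroupLieAlgebra I G}
    (hv : v ∈ subgroupLieAlgebra I H) : lieAd I h v ∈ subgroupLieAlgebra I H := by
  rw [← mfderiv_mk_eq_zero_iff hclosed hπ] at hv ⊢
  refine (mfderiv_mk_lieAd hπ hh v).trans ?_
  refine (congrArg (mfderiv 𝓘(ℝ, F) 𝓘(ℝ, F) (fun q : G ⧸ H ↦ h • q) ((1 : G) : G ⧸ H)) hv).trans ?_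
  exact map_zero _

variable {B B₀ : GroupLieAlgebra I G →L[ℝ] GroupLieAlgebra I G →L[ℝ] ℝ}

theorem lieAd_mem_formOrthogonal (hAd : AdInvariant I H B) {h : G} (hh : h ∈ H)
    {v : GroupLieAlgebra I G} (hv : v ∈ formOrthogonal B (subgroupLieAlgebra I H)) :
    lieAd I h v ∈ formOrthogonal B (subgroupLieAlgebra I H) := fun s hs ↦ by
  rw [← lieAd_lieAd_inv I h s, hAd h hh]
  exact hv _ (lieAd_mem_subgroupLieAlgebra hclosed hπ (H.inv_mem hh) hs)

/-- `Ad(H)` preserves `𝔥` and `𝔥^⊥`, and hence the horizontal part of `B`. -/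
theorem IsHorizontalPart.adInvariant (hB₀ : IsHorizontalPart B (subgroupLieAlgebra I H) B₀)
    (hsymm : FormSymm B) (hnondegH : FormNondegenerateOn B (subgroupLieAlgebra I H))
    (hAd : AdInvariant I H B) : AdInvariant I H B₀ := by
  have : FiniteDimensional ℝ (GroupLieAlgebra I G) := inferInstanceAs (FiniteDimensional ℝ E)
  intro h hh v w
  obtain ⟨s, hs, t, ht, rfl⟩ := exists_add_mem_formOrthogonal hsymm hnondegH v
  obtain ⟨s', hs', t', ht', rfl⟩ := exists_add_mem_formOrthogonal hsymm hnondegH w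
  rw [map_add (lieAd I h), map_add (lieAd I h), hB₀.apply_add hs ht hs' ht',
    hB₀.apply_add (lieAd_mem_subgroupLieAlgebra hclosed hπ hh hs)
      (lieAd_mem_formOrthogonal hclosed hπ hAd hh ht)
      (lieAd_mem_subgroupLieAlgebra hclosed hπ hh hs')
      (lieAd_mem_formOrthogonal hclosed hπ hAd hh ht'), hAd h hh]

/-! ### Vertical and horizontal spaces of the projection -/

/-- The vertical distribution is left-invariant, with value `𝔥` at `1`. -/
theorem mem_verticalSpace_mk {x : G} {v : TangentSpace I x} :
    v ∈ verticalSpace I 𝓘(ℝ, F) (fun x : G ↦ (x : G ⧸ H)) x ↔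
      leftDerivInv I x v ∈ subgroupLieAlgebra I H := by
  rw [← mfderiv_mk_eq_zero_iff hclosed hπ]
  have h0 : (mfderiv 𝓘(ℝ, F) 𝓘(ℝ, F) (fun q : G ⧸ H ↦ x • q) ((1 : G) : G ⧸ H) (0 : F) : F) = 0 :=
    map_zero _
  constructor
  · intro h
    refine mfderiv_smul_injective hπ x _ (((mfderiv_mk_eq hπ x v).symm.trans h).trans h0.symm)
  · intro h
    exact (mfderiv_mk_eq hπ x v).trans ((congrArg (mfderiv 𝓘(ℝ, F) 𝓘(ℝ, F)
      (fun q : G ⧸ H ↦ x • q) ((1 : G) : G ⧸ H)) h).trans h0)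

theorem mem_horizontalSpace_mk {x : G} {w : TangentSpace I x} :
    w ∈ horizontalSpace I 𝓘(ℝ, F) (leftInvariantForm I B) (fun x : G ↦ (x : G ⧸ H)) x ↔
      leftDerivInv I x w ∈ formOrthogonal B (subgroupLieAlgebra I H) := by
  constructor
  · intro h s hs
    have := h (leftDeriv I x s) ((mem_verticalSpace_mk hclosed hπ).2
      (by rwa [leftDerivInv_leftDeriv]))
    rwa [leftInvariantForm_apply, leftDerivInv_leftDeriv] at this
  · intro h v hv
    exact h _ ((mem_verticalSpace_mk hclosed hπ).1 hv)

/-! ### The metric of the coset space -/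

/-- Tangent vectors of `G` at two points of the same coset, with the same image in the coset space,
differ in `𝔤` by the adjoint action of the subgroup and a vertical vector. -/
theorem lieAd_sub_mem_subgroupLieAlgebra {x h : G} (hh : h ∈ H) {v v' : E}
    (hv : (mfderiv I 𝓘(ℝ, F) (fun x : G ↦ (x : G ⧸ H)) x v : F) =
      mfderiv I 𝓘(ℝ, F) (fun x : G ↦ (x : G ⧸ H)) (x * h) v') :
    (leftDerivInv I x v : GroupLieAlgebra I G) - lieAd I h (leftDerivInv I (x * h) v') ∈
      subgroupLieAlgebra I H := by
  rw [← mfderiv_mk_eq_zero_iff hclosed hπ]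
  -- the base points `h • 1` and `1` of the coset space are equal
  have e : ∀ z : G ⧸ H, z = ((1 : G) : G ⧸ H) → ∀ u : F,
      (mfderiv 𝓘(ℝ, F) 𝓘(ℝ, F) (fun q : G ⧸ H ↦ x • q) z u : F) =
        mfderiv 𝓘(ℝ, F) 𝓘(ℝ, F) (fun q : G ⧸ H ↦ x • q) ((1 : G) : G ⧸ H) u := by
    rintro _ rfl u; rfl
  have hh1 : h • ((1 : G) : G ⧸ H) = ((1 : G) : G ⧸ H) :=
    QuotientGroup.eq.2 (by simpa using hh)
  have h1 := (mfderiv_mk_eq hπ x v).symm.trans (hv.trans (mfderiv_mk_eq hπ (x * h) v'))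
  have h2 := h1.trans ((mfderiv_smul_smul hπ x h _ _).trans (e _ hh1 _))
  have h3 := (mfderiv_smul_injective hπ x _ h2).trans (mfderiv_mk_lieAd hπ hh _).symm
  refine (map_sub (mfderiv I 𝓘(ℝ, F) (fun x : G ↦ (x : G ⧸ H)) 1) _ _).trans ?_
  exact sub_eq_zero.2 h3

/-- The left-invariant field with value the horizontal part of `B` descends to the coset space.
Being `Ad(H)`-invariant with `𝔥` in its radical, it depends only on the image of tangent vectors in
the coset space. -/
theorem exists_pullback_eq_leftInvariantForm
    (hB₀ : IsHorizontalPart B (subgroupLieAlgebra I H) B₀) (hAd₀ : AdInvariant I H B₀) :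
    ∃ g : ∀ p : G ⧸ H, TangentSpace 𝓘(ℝ, F) p →L[ℝ] TangentSpace 𝓘(ℝ, F) p →L[ℝ] ℝ,
      ∀ (x : G) (v w : TangentSpace I x),
        g (x : G ⧸ H) (mfderiv I 𝓘(ℝ, F) (fun x : G ↦ (x : G ⧸ H)) x v)
          (mfderiv I 𝓘(ℝ, F) (fun x : G ↦ (x : G ⧸ H)) x w) = leftInvariantForm I B₀ x v w := by
  have key : ∀ p : G ⧸ H, ∃ gp : F →L[ℝ] F →L[ℝ] ℝ, ∀ x : G, (x : G ⧸ H) = p → ∀ v w : E,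
      gp (mfderiv I 𝓘(ℝ, F) (fun x : G ↦ (x : G ⧸ H)) x v : F)
        (mfderiv I 𝓘(ℝ, F) (fun x : G ↦ (x : G ⧸ H)) x w : F) =
        leftInvariantForm I B₀ x v w := by
    intro p
    obtain ⟨y, rfl⟩ := QuotientGroup.mk_surjective p
    obtain ⟨D, hD, hDs⟩ : ∃ D : E →L[ℝ] F,
        (∀ v : E, (mfderiv I 𝓘(ℝ, F) (fun x : G ↦ (x : G ⧸ H)) y v : F) = D v) ∧
          Function.Surjective D := ⟨_, fun _ ↦ rfl, hπ.surjective y⟩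
    obtain ⟨R₀, hR₀⟩ := D.toLinearMap.exists_rightInverse_of_surjective
      (LinearMap.range_eq_top.2 hDs)
    let R : F →L[ℝ] E := R₀.toContinuousLinearMap
    -- pull back by a right inverse of the differential of the projection at `y`
    let b : E →L[ℝ] E →L[ℝ] ℝ := leftInvariantForm I B₀ y
    refine ⟨(ContinuousLinearMap.precomp ℝ R).comp (b.comp R), fun x hx v w ↦ ?_⟩
    obtain ⟨h, hh, rfl⟩ : ∃ h ∈ H, x = y * h :=
      ⟨y⁻¹ * x, QuotientGroup.eq.1 hx.symm, by simp⟩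
    have hR : ∀ u : F, (mfderiv I 𝓘(ℝ, F) (fun x : G ↦ (x : G ⧸ H)) y (R u) : F) = u :=
      fun u ↦ (hD _).trans (DFunLike.congr_fun hR₀ u)
    have h1 := lieAd_sub_mem_subgroupLieAlgebra hclosed hπ hh (hR
      (mfderiv I 𝓘(ℝ, F) (fun x : G ↦ (x : G ⧸ H)) (y * h) v))
    have h2 := lieAd_sub_mem_subgroupLieAlgebra hclosed hπ hh (hR
      (mfderiv I 𝓘(ℝ, F) (fun x : G ↦ (x : G ⧸ H)) (y * h) w))
    exact (hB₀.congr h1 h2).trans (hAd₀ h hh _ _)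
  choose g hg using key
  exact ⟨g, fun x v w ↦ hg _ x rfl v w⟩

variable {g : ∀ p : G ⧸ H, TangentSpace 𝓘(ℝ, F) p →L[ℝ] TangentSpace 𝓘(ℝ, F) p →L[ℝ] ℝ}

omit hclosed [FiniteDimensional ℝ E] in
theorem isInducedMetric_of_pullback_eq
    (hB₀ : IsHorizontalPart B (subgroupLieAlgebra I H) B₀)
    (hg : ∀ (x : G) (v w : TangentSpace I x),
      g (x : G ⧸ H) (mfderiv I 𝓘(ℝ, F) (fun x : G ↦ (x : G ⧸ H)) x v)
        (mfderiv I 𝓘(ℝ, F) (fun x : G ↦ (x : G ⧸ H)) x w) = leftInvariantForm I B₀ x v w) :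
    IsInducedMetric I H B 𝓘(ℝ, F) g where
  base v hv w hw := by
    refine (hg 1 v w).trans ?_
    rw [leftInvariantForm_apply, leftDerivInv_one, leftDerivInv_one, hB₀.eq v hv w hw]
  invariant a p v w := by
    obtain ⟨x, rfl⟩ := QuotientGroup.mk_surjective p
    obtain ⟨v, rfl⟩ := hπ.surjective x v
    obtain ⟨w, rfl⟩ := hπ.surjective x w
    refine Eq.trans ?_ (hg x v w).symm
    refine (congrArg₂ (fun b c : F ↦ g ((a * x : G) : G ⧸ H) b c)
      (mfderiv_smul_mk hπ a x v) (mfderiv_smul_mk hπ a x w)).trans ((hg (a * x) _ _).trans ?_)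
    rw [leftInvariantForm_apply, leftDerivInv_mfderiv_mul_left, leftDerivInv_mfderiv_mul_left]
    rfl

/-- The pull-back of an induced metric to `G` is determined by `B`; this gives its uniqueness. -/
theorem IsInducedMetric.pullback_eq (hsymm : FormSymm B)
    (hnondegH : FormNondegenerateOn B (subgroupLieAlgebra I H))
    (hB₀ : IsHorizontalPart B (subgroupLieAlgebra I H) B₀)
    (hg : IsInducedMetric I H B 𝓘(ℝ, F) g) (x : G) (v w : TangentSpace I x) :
    g (x : G ⧸ H) (mfderiv I 𝓘(ℝ, F) (fun x : G ↦ (x : G ⧸ H)) x v)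
      (mfderiv I 𝓘(ℝ, F) (fun x : G ↦ (x : G ⧸ H)) x w) = leftInvariantForm I B₀ x v w := by
  have : FiniteDimensional ℝ (GroupLieAlgebra I G) := inferInstanceAs (FiniteDimensional ℝ E)
  obtain ⟨s, hs, t, ht, hst⟩ := exists_add_mem_formOrthogonal hsymm hnondegH (leftDerivInv I x v)
  obtain ⟨s', hs', t', ht', hst'⟩ :=
    exists_add_mem_formOrthogonal hsymm hnondegH (leftDerivInv I x w)
  have hD : ∀ s ∈ subgroupLieAlgebra I H, ∀ t : GroupLieAlgebra I G,
      (mfderiv I 𝓘(ℝ, F) (fun x : G ↦ (x : G ⧸ H)) 1 (s + t) : F) =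
        mfderiv I 𝓘(ℝ, F) (fun x : G ↦ (x : G ⧸ H)) 1 t := by
    intro s hs t
    refine (map_add (mfderiv I 𝓘(ℝ, F) (fun x : G ↦ (x : G ⧸ H)) 1) s t).trans ?_
    exact add_eq_right.2 ((mfderiv_mk_eq_zero_iff hclosed hπ s).2 hs)
  -- transport of `g` along the equality of the points `x • 1` and `x` of the coset space
  have e : ∀ z : G ⧸ H, z = (x : G ⧸ H) → ∀ a b : F, g (x : G ⧸ H) a b = g z (a : F) (b : F) := by
    rintro _ rfl _ _; rfl
  have hx : x • ((1 : G) : G ⧸ H) = (x : G ⧸ H) := congrArg _ (mul_one x)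
  have h1 := hg.invariant x ((1 : G) : G ⧸ H)
    (mfderiv I 𝓘(ℝ, F) (fun x : G ↦ (x : G ⧸ H)) 1 (leftDerivInv I x v))
    (mfderiv I 𝓘(ℝ, F) (fun x : G ↦ (x : G ⧸ H)) 1 (leftDerivInv I x w))
  have h2 := (congrArg₂ (fun b c : F ↦ g (x • ((1 : G) : G ⧸ H)) b c)
    (mfderiv_mk_eq hπ x v) (mfderiv_mk_eq hπ x w)).trans h1
  refine ((e _ hx _ _).trans h2).trans ?_
  rw [leftInvariantForm_apply, ← hst, ← hst', hB₀.apply_add hs ht hs' ht']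
  exact (congrArg₂ (fun b c : F ↦ g ((1 : G) : G ⧸ H) b c) (hD s hs t) (hD s' hs' t')).trans
    (hg.base t ht t' ht')

omit hclosed [FiniteDimensional ℝ E] [I.Boundaryless] [LieGroup I ∞ G] [FiniteDimensional ℝ F]
  [IsManifold 𝓘(ℝ, F) ∞ (G ⧸ H)] in
theorem eq_of_pullback_eq
    {g' : ∀ p : G ⧸ H, TangentSpace 𝓘(ℝ, F) p →L[ℝ] TangentSpace 𝓘(ℝ, F) p →L[ℝ] ℝ}
    (hg : ∀ (x : G) (v w : TangentSpace I x),
      g (x : G ⧸ H) (mfderiv I 𝓘(ℝ, F) (fun x : G ↦ (x : G ⧸ H)) x v)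
        (mfderiv I 𝓘(ℝ, F) (fun x : G ↦ (x : G ⧸ H)) x w) = leftInvariantForm I B₀ x v w)
    (hg' : ∀ (x : G) (v w : TangentSpace I x),
      g' (x : G ⧸ H) (mfderiv I 𝓘(ℝ, F) (fun x : G ↦ (x : G ⧸ H)) x v)
        (mfderiv I 𝓘(ℝ, F) (fun x : G ↦ (x : G ⧸ H)) x w) = leftInvariantForm I B₀ x v w) :
    g' = g := by
  funext p
  obtain ⟨x, rfl⟩ := QuotientGroup.mk_surjective p
  ext v w
  obtain ⟨v, rfl⟩ := hπ.surjective x v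
  obtain ⟨w, rfl⟩ := hπ.surjective x w
  exact (hg' x v w).trans (hg x v w).symm

theorem isPseudoRiemannianMetric_of_pullback_eq (hsymm : FormSymm B)
    (hnondeg : FormNondegenerateOn B ⊤)
    (hnondegH : FormNondegenerateOn B (subgroupLieAlgebra I H))
    (hB₀ : IsHorizontalPart B (subgroupLieAlgebra I H) B₀)
    (hg : ∀ (x : G) (v w : TangentSpace I x),
      g (x : G ⧸ H) (mfderiv I 𝓘(ℝ, F) (fun x : G ↦ (x : G ⧸ H)) x v)
        (mfderiv I 𝓘(ℝ, F) (fun x : G ↦ (x : G ⧸ H)) x w) = leftInvariantForm I B₀ x v w) :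
    IsPseudoRiemannianMetric 𝓘(ℝ, F) g where
  symm p v w := by
    have : FiniteDimensional ℝ (GroupLieAlgebra I G) := inferInstanceAs (FiniteDimensional ℝ E)
    obtain ⟨x, rfl⟩ := QuotientGroup.mk_surjective p
    obtain ⟨v, rfl⟩ := hπ.surjective x v
    obtain ⟨w, rfl⟩ := hπ.surjective x w
    exact (hg x v w).trans ((hB₀.symm hsymm hnondegH _ _).trans (hg x w v).symm)
  nondegenerate p v _ h := by
    have : FiniteDimensional ℝ (GroupLieAlgebra I G) := inferInstanceAs (FiniteDimensional ℝ E)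
    obtain ⟨x, rfl⟩ := QuotientGroup.mk_surjective p
    obtain ⟨v, rfl⟩ := hπ.surjective x v
    refine (mem_verticalSpace_mk hclosed hπ).2
      (hB₀.mem_of_forall hsymm hnondeg hnondegH fun u ↦ ?_)
    have h1 := (hg x v (leftDeriv I x u)).symm.trans (h _ trivial)
    rwa [leftInvariantForm_apply, leftDerivInv_leftDeriv] at h1
  smooth := contMDiff_of_pullback_eq_leftInvariantForm hπ hg

theorem isPseudoRiemannianSubmersion_mk (hsymm : FormSymm B)
    (hnondeg : FormNondegenerateOn B ⊤)
    (hnondegH : FormNondegenerateOn B (subgroupLieAlgebra I H))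
    (hB₀ : IsHorizontalPart B (subgroupLieAlgebra I H) B₀)
    (hg : ∀ (x : G) (v w : TangentSpace I x),
      g (x : G ⧸ H) (mfderiv I 𝓘(ℝ, F) (fun x : G ↦ (x : G ⧸ H)) x v)
        (mfderiv I 𝓘(ℝ, F) (fun x : G ↦ (x : G ⧸ H)) x w) = leftInvariantForm I B₀ x v w) :
    IsPseudoRiemannianSubmersion I 𝓘(ℝ, F) (leftInvariantForm I B) g
      (fun x : G ↦ (x : G ⧸ H)) where
  metric_source := isPseudoRiemannianMetric_leftInvariantForm hsymm hnondeg
  metric_target :=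
    isPseudoRiemannianMetric_of_pullback_eq hclosed hπ hsymm hnondeg hnondegH hB₀ hg
  submersion := hπ
  vertical_nondegenerate x v hv h := by
    rw [mem_verticalSpace_mk hclosed hπ] at hv
    refine leftDerivInv_injective I x ((hnondegH _ hv fun s hs ↦ ?_).trans (map_zero _).symm)
    have := h (leftDeriv I x s) ((mem_verticalSpace_mk hclosed hπ).2
      (by rwa [leftDerivInv_leftDeriv]))
    rwa [leftInvariantForm_apply, leftDerivInv_leftDeriv] at this
  isometry x v hv w hw := (hg x v w).trans <|
    hB₀.eq _ ((mem_horizontalSpace_mk hclosed hπ).1 hv) _ ((mem_horizontalSpace_mk hclosed hπ).1 hw)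

theorem isRiemannianSubmersion_mk (hpos : FormPosDef B) (hsymm : FormSymm B)
    (hnondeg : FormNondegenerateOn B ⊤)
    (hnondegH : FormNondegenerateOn B (subgroupLieAlgebra I H))
    (hB₀ : IsHorizontalPart B (subgroupLieAlgebra I H) B₀)
    (hg : ∀ (x : G) (v w : TangentSpace I x),
      g (x : G ⧸ H) (mfderiv I 𝓘(ℝ, F) (fun x : G ↦ (x : G ⧸ H)) x v)
        (mfderiv I 𝓘(ℝ, F) (fun x : G ↦ (x : G ⧸ H)) x w) = leftInvariantForm I B₀ x v w) :
    IsRiemannianSubmersion I 𝓘(ℝ, F) (leftInvariantForm I B) g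
      (fun x : G ↦ (x : G ⧸ H)) where
  toIsPseudoRiemannianSubmersion :=
    isPseudoRiemannianSubmersion_mk hclosed hπ hsymm hnondeg hnondegH hB₀ hg
  posDef_source := hpos.leftInvariantForm
  posDef_target p v hv := by
    have : FiniteDimensional ℝ (GroupLieAlgebra I G) := inferInstanceAs (FiniteDimensional ℝ E)
    obtain ⟨x, rfl⟩ := QuotientGroup.mk_surjective p
    obtain ⟨v, rfl⟩ := hπ.surjective x v
    refine (hB₀.pos hsymm hpos hnondegH fun h ↦ hv ?_).trans_eq (hg x v v).symm
    exact (mem_verticalSpace_mk hclosed hπ).2 h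

theorem mapsVerticalToHorizontal_leftInvariantEndo
    {J : GroupLieAlgebra I G →L[ℝ] GroupLieAlgebra I G}
    (hJ : ∀ v ∈ subgroupLieAlgebra I H, J v ∈ formOrthogonal B (subgroupLieAlgebra I H)) :
    MapsVerticalToHorizontal I 𝓘(ℝ, F) (leftInvariantForm I B) (leftInvariantEndo I J)
      (fun x : G ↦ (x : G ⧸ H)) := fun x v hv ↦ by
  rw [mem_horizontalSpace_mk hclosed hπ, leftDerivInv_leftInvariantEndo]
  exact hJ _ ((mem_verticalSpace_mk hclosed hπ).1 hv)

theorem isLagrangian_leftInvariantEndo_iff (hsymm : FormSymm B)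
    (hnondegH : FormNondegenerateOn B (subgroupLieAlgebra I H))
    {J : GroupLieAlgebra I G →L[ℝ] GroupLieAlgebra I G} (hinj : Function.Injective J)
    (hJ : ∀ v ∈ subgroupLieAlgebra I H, J v ∈ formOrthogonal B (subgroupLieAlgebra I H)) :
    IsLagrangian I 𝓘(ℝ, F) (leftInvariantForm I B) (leftInvariantEndo I J)
        (fun x : G ↦ (x : G ⧸ H)) ↔
      2 * Module.finrank ℝ (subgroupLieAlgebra I H) =
        Module.finrank ℝ (GroupLieAlgebra I G) := by
  have : FiniteDimensional ℝ (GroupLieAlgebra I G) := inferInstanceAs (FiniteDimensional ℝ E)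
  rw [← map_eq_formOrthogonal_iff hsymm hnondegH hinj hJ]
  have hmem : ∀ (x : G) (w : GroupLieAlgebra I G),
      leftDeriv I x w ∈ (verticalSpace I 𝓘(ℝ, F) (fun x : G ↦ (x : G ⧸ H)) x).map
        (leftInvariantEndo I J x).toLinearMap ↔
      w ∈ (subgroupLieAlgebra I H).map J.toLinearMap := by
    intro x w
    constructor
    · rintro ⟨v, hv, hvw⟩
      refine ⟨leftDerivInv I x v, (mem_verticalSpace_mk hclosed hπ).1 hv, ?_⟩
      have := congrArg (leftDerivInv I x) hvw
      rw [leftDerivInv_leftDeriv] at this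
      exact (leftDerivInv_leftInvariantEndo I J x v).symm.trans this
    · rintro ⟨s, hs, rfl⟩
      refine ⟨leftDeriv I x s, (mem_verticalSpace_mk hclosed hπ).2
        (by rwa [leftDerivInv_leftDeriv]), ?_⟩
      exact congrArg (fun u ↦ leftDeriv I x (J u)) (leftDerivInv_leftDeriv I x s)
  have hhor : ∀ (x : G) (w : GroupLieAlgebra I G),
      leftDeriv I x w ∈ horizontalSpace I 𝓘(ℝ, F) (leftInvariantForm I B)
        (fun x : G ↦ (x : G ⧸ H)) x ↔ w ∈ formOrthogonal B (subgroupLieAlgebra I H) := by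
    intro x w
    rw [mem_horizontalSpace_mk hclosed hπ, leftDerivInv_leftDeriv]
  constructor
  · intro h
    ext w
    rw [← hmem 1, ← hhor 1, h 1]
  · intro h x
    ext u
    obtain ⟨w, rfl⟩ := (leftDerivEquiv I x).surjective u
    exact (hmem x w).trans ((Submodule.ext_iff.1 h w).trans (hhor x w).symm)

end CosetMetric

end

theorem mainTheorem1
    {E : Type*} [NormedAddCommGroup E] [NormedSpace ℝ E] [FiniteDimensional ℝ E]
    {K : Type*} [TopologicalSpace K] (I : ModelWithCorners ℝ E K) [I.Boundaryless]
    {G : Type*} [TopologicalSpace G] [ChartedSpace K G] [Group G] [LieGroup I ∞ G]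
    (hG : Even (Module.finrank ℝ (GroupLieAlgebra I G)))
    (H : Subgroup G) (hclosed : IsClosed (H : Set G)) (hconn : IsConnected (H : Set G))
    (B : GroupLieAlgebra I G →L[ℝ] GroupLieAlgebra I G →L[ℝ] ℝ)
    (hsymm : FormSymm B) (hnondeg : FormNondegenerateOn B ⊤)
    (hnondegH : FormNondegenerateOn B (subgroupLieAlgebra I H))
    (hAd : AdInvariant I H B) :
    -- the coset space carries a smooth structure for which the projection is a submersion
    (∃ (k : ℕ) (_ : ChartedSpace (EuclideanSpace ℝ (Fin k)) (G ⧸ H))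
      (_ : IsManifold (𝓡 k) ∞ (G ⧸ H)),
      IsSmoothSubmersion I (𝓡 k) (fun x : G ↦ (x : G ⧸ H))) ∧
    -- and, for this smooth structure:
    ∀ (k : ℕ) [ChartedSpace (EuclideanSpace ℝ (Fin k)) (G ⧸ H)] [IsManifold (𝓡 k) ∞ (G ⧸ H)],
      IsSmoothSubmersion I (𝓡 k) (fun x : G ↦ (x : G ⧸ H)) →
      ∃ g : ∀ p : G ⧸ H, TangentSpace (𝓡 k) p →L[ℝ] TangentSpace (𝓡 k) p →L[ℝ] ℝ,
        IsInducedMetric I H B (𝓡 k) g ∧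
        (∀ g', IsInducedMetric I H B (𝓡 k) g' → g' = g) ∧
        IsPseudoRiemannianSubmersion I (𝓡 k) (leftInvariantForm I B) g
          (fun x : G ↦ (x : G ⧸ H)) ∧
        -- complex geometry, positive definite
        (FormPosDef B → ∀ J : GroupLieAlgebra I G →L[ℝ] GroupLieAlgebra I G,
          IsHermitianComplex B J →
          (∀ v ∈ subgroupLieAlgebra I H, J v ∈ formOrthogonal B (subgroupLieAlgebra I H)) →
          IsAntiInvariantAlmostHermitian I (𝓡 k) (leftInvariantForm I B) g
            (leftInvariantEndo I J) (fun x : G ↦ (x : G ⧸ H)) ∧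
          (IsLagrangian I (𝓡 k) (leftInvariantForm I B) (leftInvariantEndo I J)
              (fun x : G ↦ (x : G ⧸ H)) ↔
            2 * Module.finrank ℝ (subgroupLieAlgebra I H) =
              Module.finrank ℝ (GroupLieAlgebra I G))) ∧
        -- complex geometry, arbitrary signature
        (∀ J : GroupLieAlgebra I G →L[ℝ] GroupLieAlgebra I G,
          IsHermitianComplex B J →
          (∀ v ∈ subgroupLieAlgebra I H, J v ∈ formOrthogonal B (subgroupLieAlgebra I H)) →
          IsAntiInvariantAlmostPseudoHermitian I (𝓡 k) (leftInvariantForm I B) g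
            (leftInvariantEndo I J) (fun x : G ↦ (x : G ⧸ H)) ∧
          (IsLagrangian I (𝓡 k) (leftInvariantForm I B) (leftInvariantEndo I J)
              (fun x : G ↦ (x : G ⧸ H)) ↔
            2 * Module.finrank ℝ (subgroupLieAlgebra I H) =
              Module.finrank ℝ (GroupLieAlgebra I G))) ∧
        -- quaternion geometry
        (FormPosDef B → ∀ ρ : ℍ[ℝ] → GroupLieAlgebra I G →L[ℝ] GroupLieAlgebra I G,
          IsHermitianQuaternion B ρ →
          (∀ q : ℍ[ℝ], q.re = 0 → ∀ v ∈ subgroupLieAlgebra I H,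
            ρ q v ∈ formOrthogonal B (subgroupLieAlgebra I H)) →
          IsAntiInvariantQuaternion I (𝓡 k) (leftInvariantForm I B) g
            (fun x q ↦ leftInvariantEndo I (ρ q) x) (fun x : G ↦ (x : G ⧸ H))) ∧
        -- para-complex geometry
        (FormNeutral B → ∀ J : GroupLieAlgebra I G →L[ℝ] GroupLieAlgebra I G,
          IsHermitianParaComplex B J →
          (∀ v ∈ subgroupLieAlgebra I H, J v ∈ formOrthogonal B (subgroupLieAlgebra I H)) →
          IsAntiInvariantParaHermitian I (𝓡 k) (leftInvariantForm I B) g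
            (leftInvariantEndo I J) (fun x : G ↦ (x : G ⧸ H)) ∧
          (IsLagrangian I (𝓡 k) (leftInvariantForm I B) (leftInvariantEndo I J)
              (fun x : G ↦ (x : G ⧸ H)) ↔
            2 * Module.finrank ℝ (subgroupLieAlgebra I H) =
              Module.finrank ℝ (GroupLieAlgebra I G))) ∧
        -- para-quaternion geometry
        (FormNeutral B → ∀ ρ : ParaQuaternion → GroupLieAlgebra I G →L[ℝ] GroupLieAlgebra I G,
          IsHermitianParaQuaternion B ρ →
          (∀ q : ParaQuaternion, q.re = 0 → ∀ v ∈ subgroupLieAlgebra I H,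
            ρ q v ∈ formOrthogonal B (subgroupLieAlgebra I H)) →
          IsAntiInvariantParaQuaternion I (𝓡 k) (leftInvariantForm I B) g
            (fun x q ↦ leftInvariantEndo I (ρ q) x) (fun x : G ↦ (x : G ⧸ H))) := by
  have : FiniteDimensional ℝ (GroupLieAlgebra I G) := inferInstanceAs (FiniteDimensional ℝ E)
  have : T2Space (GroupLieAlgebra I G) := inferInstanceAs (T2Space E)
  refine ⟨exists_isSmoothSubmersion_mk I H hclosed, ?_⟩
  intro k _ _ hπ
  obtain ⟨B₀, hB₀⟩ := exists_isHorizontalPart hsymm hnondegH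
  obtain ⟨g, hg⟩ := exists_pullback_eq_leftInvariantForm hclosed hπ hB₀
    (hB₀.adInvariant hclosed hπ hsymm hnondegH hAd)
  have hsub := isPseudoRiemannianSubmersion_mk hclosed hπ hsymm hnondeg hnondegH hB₀ hg
  have hpos (h : FormPosDef B) :=
    isRiemannianSubmersion_mk hclosed hπ h hsymm hnondeg hnondegH hB₀ hg
  have hsmooth := isSmoothEndomorphism_leftInvariantEndo (G := G) I
  refine ⟨g, isInducedMetric_of_pullback_eq hπ hB₀ hg, fun g' hg' ↦ eq_of_pullback_eq hπ hg
    (hg'.pullback_eq hclosed hπ hsymm hnondegH hB₀), hsub, ?_, ?_, ?_, ?_, ?_⟩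
  · intro hB J hJ hJH
    exact ⟨⟨hpos hB, hsmooth J, hJ.leftInvariantEndo,
      mapsVerticalToHorizontal_leftInvariantEndo hclosed hπ hJH⟩,
      isLagrangian_leftInvariantEndo_iff hclosed hπ hsymm hnondegH hJ.injective hJH⟩
  · intro J hJ hJH
    exact ⟨⟨hsub, hsmooth J, hJ.leftInvariantEndo,
      mapsVerticalToHorizontal_leftInvariantEndo hclosed hπ hJH⟩,
      isLagrangian_leftInvariantEndo_iff hclosed hπ hsymm hnondegH hJ.injective hJH⟩
  · intro hB ρ hρ hρH
    exact ⟨hpos hB, fun q ↦ hsmooth (ρ q), hρ.leftInvariantEndo, fun q hq ↦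
      mapsVerticalToHorizontal_leftInvariantEndo hclosed hπ (hρH q hq)⟩
  · intro hB J hJ hJH
    exact ⟨⟨hsub, hB.leftInvariantForm, hsmooth J, hJ.leftInvariantEndo,
      mapsVerticalToHorizontal_leftInvariantEndo hclosed hπ hJH⟩,
      isLagrangian_leftInvariantEndo_iff hclosed hπ hsymm hnondegH hJ.injective hJH⟩
  · intro hB ρ hρ hρH
    exact ⟨hsub, hB.leftInvariantForm, fun q ↦ hsmooth (ρ q), hρ.leftInvariantEndo, fun q hq ↦
      mapsVerticalToHorizontal_leftInvariantEndo hclosed hπ (hρH q hq)⟩
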